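/- Let $d\in\mathbb{N}$ and $0<\alpha<\frac d2$. Let $-\Delta$ be the negative discrete Laplacian on $\ell^2(\mathbb{Z}^d)$, $(-\Delta\psi)(x)=\sum_{j=1}^d\bigl(2\psi(x)-\psi(x+e_j)-\psi(x-e_j)\bigr)$, let $(-\Delta)^\alpha$ be defined by functional calculus, write $A(x,y)$ for the matrix elements of an operator $A$ on $\ell^2(\mathbb{Z}^d)$, let $|\cdot|$ be the Euclidean norm, and set $f(k)=\sum_{j=1}^d 2(1-\cos k_j)$. For every $m>0$ the operator $(-\Delta)^\alpha+m^2$ is boundedly invertible, and for all $x,y\in\mathbb{Z}^d$ the limit $$(-\Delta)^{-\alpha}(x,y):=\lim_{m\downarrow 0}\bigl[(-\Delta)^\alpha+m^2\bigr]^{-1}(x,y)$$ exists and is given by the (absolutely convergent) Fourier integral $$(-\Delta)^{-\alpha}(x,y)=\int_{[-\pi,\pi]^d}\frac{dk}{(2\pi)^d}\,\frac{e^{i(x-y)\cdot k}}{f(k)^\alpha}.$$ This kernel is invariant under translations, i.e. $(-\Delta)^{-\alpha}(x+z,y+z)=(-\Delta)^{-\alpha}(x,y)$ for all $x,y,z\in\mathbb{Z}^d$;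 its entries satisfy $(-\Delta)^{-\alpha}(x,y)>0$ for all $x,y\in\mathbb{Z}^d$; and $$\lim_{|x-y|\to\infty}|x-y|^{d-2\alpha}\,(-\Delta)^{-\alpha}(x,y)=\mathfrak{c}_\alpha,\qquad \mathfrak{c}_\alpha:=\frac{\Gamma(\frac d2-\alpha)}{4^{\alpha}\,\pi^{d/2}\,\Gamma(\alpha)}.$$ Moreover there are constants $c_2=c_2(\alpha,d)>0$ and $C_2=C_2(\alpha,d)>0$ such that $$\frac{c_2}{|x-y|^{d-2\alpha}}\le(-\Delta)^{-\alpha}(x,y)\le\frac{C_2}{|x-y|^{d-2\alpha}}\qquad\text{for all } x\neq y .$$ -/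

import Mathlib

open Filter Topology MeasureTheory

namespace FractionalLattice

/-- The Hilbert space `ℓ²(ℤ^d)` of square summable complex functions on the lattice. -/
abbrev L2 (d : ℕ) : Type := lp (fun _ : Fin d → ℤ => ℂ) 2

theorem memlp_translate {d : ℕ} (v : Fin d → ℤ) (ψ : L2 d) :
    Memℓp (fun x : Fin d → ℤ => (ψ : (Fin d → ℤ) → ℂ) (x + v)) 2 := by
  have h := lp.memℓp ψ
  rw [memℓp_gen_iff (by norm_num)] at h ⊢
  exact (Equiv.addRight v).summable_iff.2 h

/-- The translation `(T_v ψ)(x) = ψ(x + v)` on `ℓ²(ℤ^d)`. -/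
noncomputable def translate {d : ℕ} (v : Fin d → ℤ) : L2 d →L[ℂ] L2 d :=
  LinearMap.mkContinuous
    { toFun := fun ψ => ⟨fun x => (ψ : (Fin d → ℤ) → ℂ) (x + v), memlp_translate v ψ⟩
      map_add' := fun _ _ => rfl
      map_smul' := fun _ _ => rfl } 1 (by
    intro ψ
    rw [one_mul, lp.norm_eq_tsum_rpow (by norm_num), lp.norm_eq_tsum_rpow (by norm_num)]
    refine Real.rpow_le_rpow (tsum_nonneg fun _ => by positivity) (le_of_eq ?_) (by norm_num)
    exact (Equiv.addRight v).tsum_eq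
      (fun x => ‖(ψ : (Fin d → ℤ) → ℂ) x‖ ^ (2 : ENNReal).toReal))

/-- The negative discrete Laplacian on `ℓ²(ℤ^d)`:
`(-Δ ψ)(x) = ∑_j (2 ψ(x) - ψ(x + e_j) - ψ(x - e_j))`. -/
noncomputable def negLaplacian (d : ℕ) : L2 d →L[ℂ] L2 d :=
  ∑ j : Fin d, ((2 : ℂ) • ContinuousLinearMap.id ℂ (L2 d)
    - translate (Pi.single j 1) - translate (-Pi.single j 1))

/-- The Euclidean (`ℓ²`) length of a lattice vector. -/
noncomputable def euclNorm {d : ℕ} (x : Fin d → ℤ) : ℝ := √(∑ j, (x j : ℝ) ^ 2)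

/-- The matrix element `A(x, y) = ⟨δ_x, A δ_y⟩` of a bounded operator on `ℓ²(ℤ^d)`. -/
noncomputable def entry {d : ℕ} (A : L2 d →L[ℂ] L2 d) (x y : Fin d → ℤ) : ℂ :=
  (A (lp.single 2 y (1 : ℂ)) : (Fin d → ℤ) → ℂ) x

/-- The power `A^α` of a bounded self-adjoint operator on a complex Hilbert space, by continuous
functional calculus. -/
noncomputable def opPow {H : Type*} [NormedAddCommGroup H] [InnerProductSpace ℂ H]
    [CompleteSpace H] (A : H →L[ℂ] H) (α : ℝ) : H →L[ℂ] H :=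
  cfc (fun t : ℝ => t ^ α) A

/-- The fractional power `(-Δ)^α` of the negative discrete Laplacian. -/
noncomputable def fracLaplacian (d : ℕ) (α : ℝ) : L2 d →L[ℂ] L2 d :=
  opPow (negLaplacian d) α

/-- The massive operator `(-Δ)^α + m²`. -/
noncomputable def massiveOp (d : ℕ) (α m : ℝ) : L2 d →L[ℂ] L2 d :=
  fracLaplacian d α + ((m : ℂ) ^ 2) • ContinuousLinearMap.id ℂ (L2 d)

/-- The matrix elements of the resolvent `((-Δ)^α + m²)⁻¹`. -/
noncomputable def massiveGreen (d : ℕ) (α m : ℝ) (x y : Fin d → ℤ) : ℂ :=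
  entry (Ring.inverse (massiveOp d α m)) x y

/-- The symbol `f(k) = ∑_j 2 (1 - cos k_j)` of the negative discrete Laplacian. -/
noncomputable def symbol {d : ℕ} (k : Fin d → ℝ) : ℝ := ∑ j, 2 * (1 - Real.cos (k j))

/-- The Brillouin zone `[-π, π]^d`. -/
def zone (d : ℕ) : Set (Fin d → ℝ) := Set.Icc (fun _ => -Real.pi) (fun _ => Real.pi)

/-- The integrand `e^{i x·k} / f(k)^α`. -/
noncomputable def fourierIntegrand {d : ℕ} (α : ℝ) (x : Fin d → ℤ) (k : Fin d → ℝ) : ℂ :=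
  Complex.exp (Complex.I * ((∑ j, (x j : ℝ) * k j : ℝ) : ℂ)) / ((symbol k ^ α : ℝ) : ℂ)

/-- The constant `𝔠_α = Γ(d/2 - α) / (4^α π^{d/2} Γ(α))` of the Riesz potential in `ℝ^d`. -/
noncomputable def rieszConst (d : ℕ) (α : ℝ) : ℝ :=
  Real.Gamma ((d : ℝ) / 2 - α) / ((4 : ℝ) ^ α * Real.pi ^ ((d : ℝ) / 2) * Real.Gamma α)

theorem translate_apply {d : ℕ} (v : Fin d → ℤ) (ψ : L2 d) (x : Fin d → ℤ) :
    (translate v ψ : (Fin d → ℤ) → ℂ) x = (ψ : (Fin d → ℤ) → ℂ) (x + v) := rfl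

theorem negLaplacian_apply {d : ℕ} (ψ : L2 d) (x : Fin d → ℤ) :
    (negLaplacian d ψ : (Fin d → ℤ) → ℂ) x =
      ∑ j : Fin d, (2 * (ψ : (Fin d → ℤ) → ℂ) x - (ψ : (Fin d → ℤ) → ℂ) (x + Pi.single j 1)
        - (ψ : (Fin d → ℤ) → ℂ) (x - Pi.single j 1)) := by
  rw [negLaplacian, sum_apply, lp.coeFn_sum, Finset.sum_apply]
  refine Finset.sum_congr rfl fun j _ => ?_
  change (((2 : ℂ) • ψ - translate (Pi.single j 1) ψ - translate (-Pi.single j 1) ψ : L2 d) :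
    (Fin d → ℤ) → ℂ) x = _
  rw [lp.coeFn_sub, lp.coeFn_sub, lp.coeFn_smul, sub_eq_add_neg x]
  rfl

theorem entry_eq_inner {d : ℕ} (A : L2 d →L[ℂ] L2 d) (x y : Fin d → ℤ) :
    entry A x y = inner ℂ (lp.single 2 x (1 : ℂ) : L2 d) (A (lp.single 2 y (1 : ℂ))) := by
  rw [lp.inner_single_left]
  simp [entry]

theorem adjoint_translate {d : ℕ} (v : Fin d → ℤ) :
    ContinuousLinearMap.adjoint (translate v) = translate (-v) := by
  symm
  rw [ContinuousLinearMap.eq_adjoint_iff]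
  intro ψ φ
  rw [lp.inner_eq_tsum, lp.inner_eq_tsum]
  rw [← (Equiv.addRight v).tsum_eq]
  simp [translate_apply]

/-- `-Δ` is self-adjoint, so that its continuous functional calculus is the genuine one. -/
theorem isSelfAdjoint_negLaplacian (d : ℕ) : IsSelfAdjoint (negLaplacian d) := by
  rw [ContinuousLinearMap.isSelfAdjoint_iff']
  simp only [negLaplacian, map_sum, map_sub, adjoint_translate, neg_neg]
  refine Finset.sum_congr rfl fun j _ => ?_
  have : ContinuousLinearMap.adjoint ((2 : ℂ) • ContinuousLinearMap.id ℂ (L2 d))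
      = (2 : ℂ) • ContinuousLinearMap.id ℂ (L2 d) := by
    symm
    rw [ContinuousLinearMap.eq_adjoint_iff]
    intro ψ φ
    have h2 : (starRingEnd ℂ) (2 : ℂ) = 2 := Complex.conj_ofNat 2
    simp [inner_smul_left, inner_smul_right, h2]
  rw [this]
  abel

end FractionalLattice

/-! The proof rests on the subordination formula `λ^{-α} = Γ(α)⁻¹ ∫₀^∞ t^{α-1} e^{-tλ} dt`. With `λ`
the symbol, it makes the massless kernel a time integral of the lattice heat kernel (`greenFn`), and
the heat kernel factorises over coordinates because the symbol is a sum over coordinates.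

Resolvent. A polynomial in `-Δ` has the Fourier coefficients of the same polynomial in the symbol as
its entries. Weierstrass approximation carries this over to `(t^α + m²)⁻¹` (`massiveGreen_eq`).
Letting `m ↓ 0` is dominated convergence with majorant `f^{-α}`, and Fubini identifies the limit
with `greenFn` (`greenFn_eq_fourier`).

Positivity. In one dimension, expanding `e^{2t cos k}` writes the heat kernel as a Poisson-weighted
count of nearest-neighbour walks (`hasSum_heat`), which is positive.

Asymptotics. Substituting `t = |z|² s` turns `|z|^{d-2α} G(z)` into an integral over `s` of rescaled
heat kernels. A local limit theorem, uniform in the lattice point (`abs_sqrt_mul_heat_sub_le`),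
gives the pointwise limit; it is Gaussian and hence depends on `|z|` alone. Off-diagonal decay from
a contour shift (`heat_le_exp_decay`) supplies the integrable majorant, and the limiting integral is
a Gamma integral (`integral_scaled_limit`). The two-sided bound follows from the positive limit,
since only finitely many points lie in a ball. -/

namespace FractionalLattice

/-! ### One-dimensional heat kernel: Fourier form and on-diagonal decay -/

/-- The heat kernel `e^{tΔ}(0, n)` of the one-dimensional lattice. -/
noncomputable def heat (t : ℝ) (n : ℤ) : ℝ :=
  (1 / (2 * Real.pi)) *
    ∫ k in (-Real.pi)..Real.pi, Real.cos (n * k) * Real.exp (-(t * (2 * (1 - Real.cos k))))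

theorem integral_sin_mul_even_eq_zero (g : ℝ → ℝ) (hg : ∀ k, g (-k) = g k) (a n : ℝ) :
    ∫ k in (-a)..a, Real.sin (n * k) * g k = 0 := by
  have h := intervalIntegral.integral_comp_neg (a := -a) (b := a)
    (fun k => Real.sin (n * k) * g k)
  simp only [hg, mul_neg, Real.sin_neg, neg_mul, neg_neg, intervalIntegral.integral_neg] at h
  linarith

/-- The sine part is odd and integrates to zero. The exponential form is the one that multiplies
over coordinates and admits contour shifts. -/
theorem heat_ofReal (t : ℝ) (n : ℤ) :
    (heat t n : ℂ) = (1 / ((2 * Real.pi : ℝ) : ℂ)) * ∫ k in (-Real.pi)..Real.pi,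
      Complex.exp (Complex.I * ((n * k : ℝ) : ℂ)) *
        (Real.exp (-(t * (2 * (1 - Real.cos k)))) : ℂ) := by
  have h : ∀ k : ℝ, Complex.exp (Complex.I * ((n * k : ℝ) : ℂ)) *
        (Real.exp (-(t * (2 * (1 - Real.cos k)))) : ℂ)
      = ((Real.cos (n * k) * Real.exp (-(t * (2 * (1 - Real.cos k)))) : ℝ) : ℂ)
        + Complex.I *
          ((Real.sin (n * k) * Real.exp (-(t * (2 * (1 - Real.cos k)))) : ℝ) : ℂ) := by
    intro k
    rw [mul_comm Complex.I, Complex.exp_mul_I]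
    push_cast
    ring
  simp only [h]
  rw [intervalIntegral.integral_add, intervalIntegral.integral_const_mul,
    intervalIntegral.integral_ofReal, intervalIntegral.integral_ofReal,
    integral_sin_mul_even_eq_zero _ (fun k => by simp), heat]
  · push_cast
    ring
  · exact Continuous.intervalIntegrable (by fun_prop) _ _
  · exact Continuous.intervalIntegrable (by fun_prop) _ _

theorem abs_heat_le (t : ℝ) (n : ℤ) : |heat t n| ≤ heat t 0 := by
  have hpi := Real.pi_pos
  rw [heat, heat, abs_mul, abs_of_pos (by positivity)]
  refine mul_le_mul_of_nonneg_left ?_ (by positivity)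
  refine (intervalIntegral.abs_integral_le_integral_abs (by linarith)).trans ?_
  refine intervalIntegral.integral_mono_on (by linarith)
    (Continuous.intervalIntegrable (by fun_prop) _ _)
    (Continuous.intervalIntegrable (by fun_prop) _ _) fun k _ => ?_
  rw [abs_mul, Real.abs_exp, Int.cast_zero, zero_mul, Real.cos_zero]
  exact mul_le_mul_of_nonneg_right (Real.abs_cos_le_one _) (Real.exp_pos _).le

theorem heat_neg (t : ℝ) (n : ℤ) : heat t (-n) = heat t n := by
  simp [heat]

theorem two_mul_one_sub_cos_ge {k : ℝ} (hk : |k| ≤ Real.pi) :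
    4 / Real.pi ^ 2 * k ^ 2 ≤ 2 * (1 - Real.cos k) := by
  have := Real.cos_le_one_sub_mul_cos_sq hk
  have h : 4 / Real.pi ^ 2 * k ^ 2 = 2 * (2 / Real.pi ^ 2 * k ^ 2) := by ring
  linarith

theorem heat_zero_nonneg (t : ℝ) : 0 ≤ heat t 0 := (abs_nonneg _).trans (abs_heat_le t 0)

theorem heat_zero_antitone {s t : ℝ} (h : s ≤ t) : heat t 0 ≤ heat s 0 := by
  have hpi := Real.pi_pos
  rw [heat, heat]
  refine mul_le_mul_of_nonneg_left ?_ (by positivity)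
  refine intervalIntegral.integral_mono_on (by linarith)
    (Continuous.intervalIntegrable (by fun_prop) _ _)
    (Continuous.intervalIntegrable (by fun_prop) _ _) fun k _ => ?_
  have := Real.cos_le_one k
  simp only [Int.cast_zero, zero_mul, Real.cos_zero, one_mul, Real.exp_le_exp, neg_le_neg_iff]
  exact mul_le_mul_of_nonneg_right h (by linarith)

theorem heat_zero_le_one {t : ℝ} (ht : 0 ≤ t) : heat t 0 ≤ 1 := by
  refine (heat_zero_antitone ht).trans (le_of_eq ?_)
  have hpi := Real.pi_pos
  simp only [heat, Int.cast_zero, zero_mul, Real.cos_zero, neg_zero, Real.exp_zero, one_mul,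
    intervalIntegral.integral_const, smul_eq_mul]
  field_simp
  ring

theorem heat_zero_le_inv_sqrt {t : ℝ} (ht : 0 < t) : heat t 0 ≤ 1 / √t := by
  have hpi := Real.pi_pos
  -- The Gaussian rate given by `2 (1 - cos k) ≥ 4 k² / π²` on the zone.
  set b : ℝ := 4 * t / Real.pi ^ 2 with hb
  have hb0 : 0 < b := by positivity
  have h1 : ∫ k in (-Real.pi)..Real.pi,
      Real.cos ((0 : ℤ) * k) * Real.exp (-(t * (2 * (1 - Real.cos k)))) ≤ √(Real.pi / b) := by
    rw [← integral_gaussian b, intervalIntegral.integral_of_le (by linarith)]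
    refine le_trans ?_ (setIntegral_le_integral (s := Set.Ioc (-Real.pi) Real.pi)
      (integrable_exp_neg_mul_sq hb0) (ae_of_all _ fun _ => by positivity))
    refine setIntegral_mono_on ?_ (integrable_exp_neg_mul_sq hb0).integrableOn
      measurableSet_Ioc fun k hk => ?_
    · exact (Continuous.integrableOn_Icc (by fun_prop)).mono_set Set.Ioc_subset_Icc_self
    · simp only [Int.cast_zero, zero_mul, Real.cos_zero, one_mul, Real.exp_le_exp]
      have h := two_mul_one_sub_cos_ge (abs_le.2 ⟨hk.1.le, hk.2⟩)
      have h2 := mul_le_mul_of_nonneg_left h ht.le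
      have : b * k ^ 2 = t * (4 / Real.pi ^ 2 * k ^ 2) := by rw [hb]; ring
      linarith
  have h2 : √(Real.pi / b) ≤ 2 * Real.pi / √t := by
    rw [Real.sqrt_le_left (by positivity), div_pow, Real.sq_sqrt ht.le, hb]
    rw [div_div_eq_mul_div, div_le_div_iff₀ (by positivity) ht]
    have := Real.pi_lt_four
    nlinarith [mul_pos (pow_pos hpi 2) ht]
  calc heat t 0 ≤ 1 / (2 * Real.pi) * (2 * Real.pi / √t) := by
        rw [heat]
        exact mul_le_mul_of_nonneg_left (h1.trans h2) (by positivity)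
    _ = 1 / √t := by field_simp

theorem heat_zero_le {t : ℝ} (ht : 0 ≤ t) : heat t 0 ≤ 2 / √(1 + t) := by
  have h0 : 0 < √(1 + t) := Real.sqrt_pos.2 (by linarith)
  rcases le_total t 1 with h | h
  · refine (heat_zero_le_one ht).trans ?_
    rw [le_div_iff₀ h0, one_mul, Real.sqrt_le_left (by norm_num)]
    linarith
  · have ht0 : 0 < t := by linarith
    refine (heat_zero_le_inv_sqrt ht0).trans ?_
    rw [div_le_div_iff₀ (Real.sqrt_pos.2 ht0) h0, one_mul, Real.sqrt_le_left (by positivity),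
      mul_pow, Real.sq_sqrt ht]
    linarith

/-! ### Positivity of the heat kernel by counting walks -/

/-- The number of nearest-neighbour walks of length `l` on `ℤ` from `n` to `0`. -/
def walkCount : ℕ → ℤ → ℕ
  | 0, n => if n = 0 then 1 else 0
  | l + 1, n => walkCount l (n + 1) + walkCount l (n - 1)

theorem integral_cos_int_mul (n : ℤ) :
    ∫ k in (-Real.pi)..Real.pi, Real.cos (n * k) = if n = 0 then 2 * Real.pi else 0 := by
  split_ifs with h
  · subst h
    simp
    ring
  · have hn : (n : ℝ) ≠ 0 := by exact_mod_cast h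
    rw [intervalIntegral.integral_comp_mul_left _ hn]
    simp [Real.sin_int_mul_pi]

/-- The identity `2 cos k cos (nk) = cos ((n+1)k) + cos ((n-1)k)` reproduces the recursion of
`walkCount`. -/
theorem integral_cos_mul_two_cos_pow (l : ℕ) (n : ℤ) :
    ∫ k in (-Real.pi)..Real.pi, Real.cos (n * k) * (2 * Real.cos k) ^ l
      = 2 * Real.pi * walkCount l n := by
  induction l generalizing n with
  | zero => simp [walkCount, integral_cos_int_mul]
  | succ l ih =>
    have h : ∀ k : ℝ, Real.cos (n * k) * (2 * Real.cos k) ^ (l + 1)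
        = Real.cos ((n + 1 : ℤ) * k) * (2 * Real.cos k) ^ l
          + Real.cos ((n - 1 : ℤ) * k) * (2 * Real.cos k) ^ l := by
      intro k
      push_cast
      rw [add_mul (n : ℝ), sub_mul (n : ℝ), one_mul, Real.cos_add, Real.cos_sub]
      ring
    simp only [h]
    rw [intervalIntegral.integral_add (Continuous.intervalIntegrable (by fun_prop) _ _)
      (Continuous.intervalIntegrable (by fun_prop) _ _), ih, ih, walkCount]
    push_cast
    ring

theorem walkCount_natAbs_pos (l : ℕ) (n : ℤ) (h : n.natAbs = l) : 0 < walkCount l n := by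
  induction l generalizing n with
  | zero => simp [walkCount, Int.natAbs_eq_zero.1 h]
  | succ l ih =>
    rw [walkCount]
    rcases le_or_gt n 0 with hn | hn
    · have := ih (n + 1) (by omega)
      omega
    · have := ih (n - 1) (by omega)
      omega

/-- Factor out `e^{-2t}` and expand `e^{2t cos k}` in powers of `t`. The cosine integral hides the
sign of the heat kernel; for `t ≥ 0` every term of this series is nonnegative. -/
theorem hasSum_heat (t : ℝ) (n : ℤ) :
    HasSum (fun l : ℕ => Real.exp (-(2 * t)) * (t ^ l / l.factorial * walkCount l n))
      (heat t n) := by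
  have hpi := Real.pi_pos
  have hs : HasSum (fun l : ℕ => ∫ k in (-Real.pi)..Real.pi,
      t ^ l / l.factorial * (Real.cos (n * k) * (2 * Real.cos k) ^ l))
      (∫ k in (-Real.pi)..Real.pi, Real.cos (n * k) * Real.exp (t * (2 * Real.cos k))) := by
    refine intervalIntegral.hasSum_integral_of_dominated_convergence
      (fun l _ => (|t| * 2) ^ l / l.factorial) (fun l => ?_) (fun l => ?_) ?_ ?_ ?_
    · exact Continuous.aestronglyMeasurable (by fun_prop)
    · refine ae_of_all _ fun k _ => ?_
      rw [Real.norm_eq_abs, abs_mul, abs_div, abs_mul, abs_pow, abs_pow, abs_mul, mul_pow]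
      have h1 := Real.abs_cos_le_one (n * k)
      have h2 : |Real.cos k| ^ l ≤ 1 := pow_le_one₀ (abs_nonneg _) (Real.abs_cos_le_one k)
      have h3 : |(2 : ℝ)| = 2 := by norm_num
      rw [h3, Nat.abs_cast, div_mul_eq_mul_div, mul_pow]
      refine div_le_div_of_nonneg_right ?_ (by positivity)
      refine mul_le_mul_of_nonneg_left ?_ (by positivity)
      calc |Real.cos (n * k)| * (2 ^ l * |Real.cos k| ^ l) ≤ 1 * (2 ^ l * 1) := by gcongr
        _ = 2 ^ l := by ring
    · exact ae_of_all _ fun k _ => Real.summable_pow_div_factorial _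
    · simp
    · refine ae_of_all _ fun k _ => ?_
      have := (NormedSpace.expSeries_div_hasSum_exp (t * (2 * Real.cos k))).mul_left
        (Real.cos (n * k))
      rw [← Real.exp_eq_exp_ℝ] at this
      refine this.congr_fun fun l => ?_
      rw [mul_pow]
      ring
  have hs2 := (hs.mul_left (Real.exp (-(2 * t)))).mul_left (1 / (2 * Real.pi))
  have hl : ∀ l : ℕ, Real.exp (-(2 * t)) * (t ^ l / l.factorial * walkCount l n)
      = 1 / (2 * Real.pi) * (Real.exp (-(2 * t)) * ∫ k in (-Real.pi)..Real.pi,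
        t ^ l / l.factorial * (Real.cos (n * k) * (2 * Real.cos k) ^ l)) := fun l => by
    rw [intervalIntegral.integral_const_mul, integral_cos_mul_two_cos_pow]
    field_simp
  have hr : heat t n = 1 / (2 * Real.pi) * (Real.exp (-(2 * t)) *
      ∫ k in (-Real.pi)..Real.pi, Real.cos (n * k) * Real.exp (t * (2 * Real.cos k))) := by
    rw [heat, ← intervalIntegral.integral_const_mul (Real.exp (-(2 * t)))]
    congr 2
    funext k
    rw [mul_left_comm (Real.exp (-(2 * t))), ← Real.exp_add]
    ring_nf
  rw [funext hl, hr]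
  exact hs2

theorem heat_pos {t : ℝ} (ht : 0 < t) (n : ℤ) : 0 < heat t n := by
  have h := hasSum_heat t n
  rw [← h.tsum_eq]
  -- The term `l = |n|` is strictly positive: the straight walk reaches the origin.
  refine h.summable.tsum_pos (fun l => by positivity) n.natAbs ?_
  have := walkCount_natAbs_pos _ n rfl
  positivity

/-! ### Off-diagonal decay by a contour shift -/

/-- Cauchy's theorem on a rectangle one period wide: the two vertical sides cancel by periodicity.
-/
theorem integral_add_I_mul_eq_of_periodic (F : ℂ → ℂ) (hF : Differentiable ℂ F)
    (hper : ∀ z, F (z + (2 * Real.pi : ℝ)) = F z) (a : ℝ) :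
    ∫ k in (-Real.pi)..Real.pi, F ((k : ℂ) + a * Complex.I)
      = ∫ k in (-Real.pi)..Real.pi, F (k : ℂ) := by
  have h := Complex.integral_boundary_rect_eq_zero_of_differentiableOn F
    (⟨-Real.pi, 0⟩ : ℂ) (⟨Real.pi, a⟩ : ℂ) hF.differentiableOn
  have hv : ∀ y : ℝ, F ((Real.pi : ℂ) + y * Complex.I)
      = F (((-Real.pi : ℝ) : ℂ) + y * Complex.I) := fun y => by
    rw [← hper (((-Real.pi : ℝ) : ℂ) + y * Complex.I)]
    congr 1
    push_cast
    ring
  simp only [hv, Complex.ofReal_zero, zero_mul, add_zero] at h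
  rw [add_sub_cancel_right, sub_eq_zero] at h
  exact h.symm

/-- Shifting `k` to `k + ia` gains `e^{-an}` and replaces `cos k` by `cos k cosh a` in the modulus.
The modulus then integrates to a heat kernel on the diagonal at the later time `t cosh a`, which is
at most the one at time `t`. -/
theorem heat_le_exp_mul (t a : ℝ) (n : ℤ) (ht : 0 ≤ t) :
    heat t n ≤ Real.exp (-(a * n) + 2 * t * (Real.cosh a - 1)) * heat t 0 := by
  have hpi := Real.pi_pos
  set F : ℂ → ℂ := fun z => Complex.exp (Complex.I * (n * z)) *
    Complex.exp (-(t * (2 * (1 - Complex.cos z)))) with hF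
  have hd : Differentiable ℂ F := by
    rw [hF]
    fun_prop
  have hper : ∀ z, F (z + (2 * Real.pi : ℝ)) = F z := fun z => by
    simp only [hF]
    push_cast
    rw [Complex.cos_add_two_pi]
    congr 1
    rw [mul_add, mul_add, Complex.exp_add,
      show Complex.I * (n * (2 * (Real.pi : ℂ))) = n * (2 * Real.pi * Complex.I) by ring,
      Complex.exp_int_mul_two_pi_mul_I, mul_one]
  have h1 : (heat t n : ℂ) = (1 / ((2 * Real.pi : ℝ) : ℂ)) *
      ∫ k in (-Real.pi)..Real.pi, F ((k : ℂ) + a * Complex.I) := by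
    rw [heat_ofReal, integral_add_I_mul_eq_of_periodic F hd hper]
    simp only [hF]
    push_cast
    rfl
  have h2 : ∀ k : ℝ, ‖F ((k : ℂ) + a * Complex.I)‖
      = Real.exp (-(a * n) + 2 * t * (Real.cosh a - 1)) *
        Real.exp (-((t * Real.cosh a) * (2 * (1 - Real.cos k)))) := fun k => by
    simp only [hF]
    rw [norm_mul, Complex.norm_exp, Complex.norm_exp, Complex.cos_add_mul_I, ← Real.exp_add,
      ← Real.exp_add]
    congr 1
    rw [← Complex.ofReal_cos, ← Complex.ofReal_sin, ← Complex.ofReal_cosh, ← Complex.ofReal_sinh]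
    simp
    rw [Complex.cos_ofReal_re]
    ring
  have h3 : heat t n ≤ Real.exp (-(a * n) + 2 * t * (Real.cosh a - 1))
      * heat (t * Real.cosh a) 0 := by
    refine (le_abs_self _).trans ?_
    rw [← Real.norm_eq_abs, ← Complex.norm_real, h1, norm_mul]
    have : ‖(1 / ((2 * Real.pi : ℝ) : ℂ))‖ = 1 / (2 * Real.pi) := by
      rw [norm_div, norm_one, Complex.norm_real, Real.norm_of_nonneg (by positivity)]
    rw [this, heat, mul_left_comm]
    refine mul_le_mul_of_nonneg_left ?_ (by positivity)
    refine (intervalIntegral.norm_integral_le_integral_norm (by linarith)).trans (le_of_eq ?_)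
    simp only [h2, intervalIntegral.integral_const_mul, Int.cast_zero, zero_mul, Real.cos_zero,
      one_mul]
  refine h3.trans (mul_le_mul_of_nonneg_left (heat_zero_antitone ?_) (Real.exp_pos _).le)
  exact le_mul_of_one_le_right ht (Real.one_le_cosh a)

theorem heat_le_exp_decay {t : ℝ} (ht : 0 ≤ t) (n : ℤ) :
    heat t n ≤ Real.exp 2 * Real.exp (-(|(n : ℝ)| / √(1 + t))) * (2 / √(1 + t)) := by
  wlog hn : 0 ≤ n generalizing n with H
  · have := H (-n) (by omega)
    simpa [heat_neg] using this
  have hr : 0 < √(1 + t) := Real.sqrt_pos.2 (by linarith)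
  have hr1 : 1 ≤ √(1 + t) := Real.one_le_sqrt.2 (by linarith)
  have hsq : √(1 + t) ^ 2 = 1 + t := Real.sq_sqrt (by linarith)
  set r := √(1 + t) with hrdef
  -- The shift `a = 1/√(1+t)` is of diffusive size: `cosh a - 1 ≤ e^{a²/2} - 1 ≤ a²`, so the loss
  -- `2t (cosh a - 1)` in the exponent is at most `2`.
  have hcosh : Real.cosh (1 / r) - 1 ≤ 1 / (1 + t) := by
    have h1 := Real.cosh_le_exp_half_sq (1 / r)
    have h0 : (1 / r) ^ 2 = 1 / (1 + t) := by rw [div_pow, hsq, one_pow]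
    have h3 : 1 / (1 + t) ≤ 1 := by rw [div_le_one (by linarith)]; linarith
    have h4 : 0 ≤ 1 / (1 + t) := by positivity
    rw [h0] at h1
    have h2 := Real.abs_exp_sub_one_le (x := 1 / (1 + t) / 2)
      (by rw [abs_of_nonneg (by positivity)]; linarith)
    rw [abs_of_nonneg (a := 1 / (1 + t) / 2) (by positivity)] at h2
    have := (abs_le.1 h2).2
    linarith
  have h5 : 2 * t * (Real.cosh (1 / r) - 1) ≤ 2 := by
    have h6 : 2 * t * (Real.cosh (1 / r) - 1) ≤ 2 * t * (1 / (1 + t)) :=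
      mul_le_mul_of_nonneg_left hcosh (by linarith)
    have h7 : t * (1 / (1 + t)) ≤ 1 := by
      rw [mul_one_div, div_le_one (by linarith)]; linarith
    linarith
  refine (heat_le_exp_mul t (1 / r) n ht).trans ?_
  rw [← Real.exp_add]
  refine mul_le_mul (Real.exp_le_exp.2 ?_) (heat_zero_le ht) (heat_zero_nonneg t)
    (Real.exp_pos _).le
  rw [abs_of_nonneg (by exact_mod_cast hn), one_div_mul_eq_div]
  linarith

theorem heat_mul_pow_le {t : ℝ} (ht : 0 ≤ t) (n : ℤ) (d : ℕ) :
    |(n : ℝ)| ^ d * heat t n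
      ≤ Real.exp 2 * 2 * d.factorial * (√(1 + t) ^ d / √(1 + t)) := by
  have hr : 0 < √(1 + t) := Real.sqrt_pos.2 (by linarith)
  have h := mul_le_mul_of_nonneg_left (heat_le_exp_decay ht n) (pow_nonneg (abs_nonneg (n : ℝ)) d)
  set r := √(1 + t) with hrdef
  refine h.trans ?_
  have h1 := Real.pow_div_factorial_le_exp (|(n : ℝ)| / r) (by positivity) d
  rw [div_pow, div_div, div_le_iff₀ (by positivity)] at h1
  have h2 : |(n : ℝ)| ^ d * Real.exp (-(|(n : ℝ)| / r)) ≤ r ^ d * d.factorial := by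
    rw [Real.exp_neg, ← div_eq_mul_inv, div_le_iff₀ (Real.exp_pos _)]
    linarith
  calc |(n : ℝ)| ^ d * (Real.exp 2 * Real.exp (-(|(n : ℝ)| / r)) * (2 / r))
      = (|(n : ℝ)| ^ d * Real.exp (-(|(n : ℝ)| / r))) * (Real.exp 2 * (2 / r)) := by ring
    _ ≤ (r ^ d * d.factorial) * (Real.exp 2 * (2 / r)) :=
        mul_le_mul_of_nonneg_right h2 (by positivity)
    _ = _ := by ring

/-! ### Local limit theorem in one dimension -/

/-- The rescaled Fourier weight of the lattice heat kernel, cut off outside the Brillouin zone. -/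
noncomputable def scaledWeight (t θ : ℝ) : ℝ :=
  (Set.Ioc (-Real.pi) Real.pi).indicator
    (fun k => Real.exp (-(t * (2 * (1 - Real.cos k))))) (θ / √t)

theorem measurable_scaledWeight (t : ℝ) : Measurable (scaledWeight t) := by
  refine Measurable.comp (g := (Set.Ioc (-Real.pi) Real.pi).indicator
    (fun k => Real.exp (-(t * (2 * (1 - Real.cos k)))))) ?_ (by fun_prop)
  exact Measurable.indicator (by fun_prop) measurableSet_Ioc

theorem abs_scaledWeight_le {t : ℝ} (ht : 0 < t) (θ : ℝ) :
    |scaledWeight t θ| ≤ Real.exp (-(4 / Real.pi ^ 2) * θ ^ 2) := by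
  rw [scaledWeight]
  by_cases h : θ / √t ∈ Set.Ioc (-Real.pi) Real.pi
  · rw [Set.indicator_of_mem h, Real.abs_exp, Real.exp_le_exp]
    have h1 := mul_le_mul_of_nonneg_left
      (two_mul_one_sub_cos_ge (abs_le.2 ⟨h.1.le, h.2⟩)) ht.le
    rw [div_pow, Real.sq_sqrt ht.le] at h1
    have h2 : t * (4 / Real.pi ^ 2 * (θ ^ 2 / t)) = 4 / Real.pi ^ 2 * θ ^ 2 := by field_simp
    linarith
  · rw [Set.indicator_of_notMem h, abs_zero]
    positivity

theorem tendsto_scaledWeight (θ : ℝ) :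
    Tendsto (fun t => scaledWeight t θ) atTop (𝓝 (Real.exp (-(1 : ℝ) * θ ^ 2))) := by
  have hpi := Real.pi_gt_three
  have hs : Tendsto (fun t : ℝ => θ / √t) atTop (𝓝 0) :=
    tendsto_const_nhds.div_atTop Real.tendsto_sqrt_atTop
  have hev : ∀ᶠ t : ℝ in atTop, |θ / √t| < 1 := by
    have := hs.abs
    rw [abs_zero] at this
    exact this.eventually_lt_const one_pos
  -- The quartic Taylor bound on the cosine leaves an error of order `t (θ/√t)⁴ = θ⁴/t`.
  have hlim : Tendsto (fun t : ℝ => t * (2 * (1 - Real.cos (θ / √t)))) atTop (𝓝 (θ ^ 2)) := by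
    rw [tendsto_iff_norm_sub_tendsto_zero]
    have hz : Tendsto (fun t : ℝ => θ ^ 4 / t) atTop (𝓝 0) :=
      tendsto_const_nhds.div_atTop tendsto_id
    refine squeeze_zero' (Eventually.of_forall fun _ => norm_nonneg _) ?_ hz
    filter_upwards [hev, eventually_gt_atTop 0] with t h1 ht
    have hb := Real.cos_bound h1.le
    have hsq : √t ^ 2 = t := Real.sq_sqrt ht.le
    have e1 : t * (2 * (1 - Real.cos (θ / √t))) - θ ^ 2
        = -(2 * t) * (Real.cos (θ / √t) - (1 - (θ / √t) ^ 2 / 2)) := by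
      rw [div_pow, hsq]
      field_simp
      ring
    have e2 : |θ / √t| ^ 4 = θ ^ 4 / t ^ 2 := by
      rw [← abs_pow, abs_of_nonneg (by positivity), div_pow]
      congr 1
      rw [← hsq]
      ring_nf
      rw [hsq]
    rw [e1, Real.norm_eq_abs, abs_mul, abs_neg, abs_of_pos (by positivity)]
    rw [e2] at hb
    calc 2 * t * |Real.cos (θ / √t) - (1 - (θ / √t) ^ 2 / 2)|
        ≤ 2 * t * (θ ^ 4 / t ^ 2 * (5 / 96)) := by gcongr
      _ = (5 / 48) * (θ ^ 4 / t) := by field_simp; ring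
      _ ≤ θ ^ 4 / t := by
        have : 0 ≤ θ ^ 4 / t := by positivity
        linarith
  have hexp := (Real.continuous_exp.tendsto _).comp hlim.neg
  rw [neg_one_mul]
  refine hexp.congr' ?_
  filter_upwards [hev] with t h1
  have h2 := abs_lt.1 h1
  have hm : θ / √t ∈ Set.Ioc (-Real.pi) Real.pi := ⟨by linarith, by linarith⟩
  rw [scaledWeight, Set.indicator_of_mem hm]
  rfl

theorem integrable_scaledWeight {t : ℝ} (ht : 0 < t) : Integrable (scaledWeight t) :=
  (integrable_exp_neg_mul_sq (b := 4 / Real.pi ^ 2) (by positivity)).mono'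
    (measurable_scaledWeight t).aestronglyMeasurable
    (ae_of_all _ fun θ => abs_scaledWeight_le ht θ)

theorem tendsto_integral_scaledWeight_sub :
    Tendsto (fun t => ∫ θ, |scaledWeight t θ - Real.exp (-(1 : ℝ) * θ ^ 2)|) atTop (𝓝 0) := by
  have h0 : (0 : ℝ) = ∫ θ : ℝ, (0 : ℝ) := by simp
  rw [h0]
  refine tendsto_integral_filter_of_dominated_convergence
    (fun θ => Real.exp (-(4 / Real.pi ^ 2) * θ ^ 2) + Real.exp (-(1 : ℝ) * θ ^ 2))
    (Eventually.of_forall fun t => ?_) ?_ ?_ (ae_of_all _ fun θ => ?_)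
  · have := measurable_scaledWeight t
    exact Measurable.aestronglyMeasurable (by fun_prop)
  · filter_upwards [eventually_gt_atTop 0] with t ht
    refine ae_of_all _ fun θ => ?_
    rw [Real.norm_eq_abs, abs_abs]
    refine (abs_sub _ _).trans (add_le_add (abs_scaledWeight_le ht θ) ?_)
    rw [Real.abs_exp]
  · exact (integrable_exp_neg_mul_sq (by positivity)).add (integrable_exp_neg_mul_sq one_pos)
  · have := ((tendsto_scaledWeight θ).sub_const (Real.exp (-(1 : ℝ) * θ ^ 2))).abs
    simpa using this

theorem sqrt_mul_heat_eq {t : ℝ} (ht : 0 < t) (n : ℤ) :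
    ((√t * heat t n : ℝ) : ℂ) = (1 / ((2 * Real.pi : ℝ) : ℂ)) *
      ∫ θ : ℝ, Complex.exp (Complex.I * ((n / √t : ℝ) : ℂ) * θ) * (scaledWeight t θ : ℂ) := by
  have hpi := Real.pi_pos
  have hs : 0 < √t := Real.sqrt_pos.2 ht
  have h := Measure.integral_comp_div (fun k : ℝ => (Set.Ioc (-Real.pi) Real.pi).indicator
    (fun k : ℝ => Complex.exp (Complex.I * ((n * k : ℝ) : ℂ)) *
        (Real.exp (-(t * (2 * (1 - Real.cos k)))) : ℂ)) k) (√t)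
  rw [integral_indicator measurableSet_Ioc, ← intervalIntegral.integral_of_le (by linarith),
    abs_of_pos hs] at h
  have hI : ∀ θ : ℝ, Complex.exp (Complex.I * ((n / √t : ℝ) : ℂ) * θ) * (scaledWeight t θ : ℂ)
      = (Set.Ioc (-Real.pi) Real.pi).indicator
    (fun k : ℝ => Complex.exp (Complex.I * ((n * k : ℝ) : ℂ)) *
        (Real.exp (-(t * (2 * (1 - Real.cos k)))) : ℂ)) (θ / √t) := fun θ => by
    rw [scaledWeight]
    by_cases hm : θ / √t ∈ Set.Ioc (-Real.pi) Real.pi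
    · rw [Set.indicator_of_mem hm, Set.indicator_of_mem hm]
      congr 2
      push_cast
      ring
    · rw [Set.indicator_of_notMem hm, Set.indicator_of_notMem hm]
      simp
  simp only [hI]
  rw [h, Complex.ofReal_mul, heat_ofReal, Complex.real_smul]
  ring

theorem gaussian_eq_integral {t : ℝ} (ht : 0 < t) (n : ℤ) :
    ((1 / √(4 * Real.pi) * Real.exp (-((n : ℝ) ^ 2 / (4 * t))) : ℝ) : ℂ)
      = (1 / ((2 * Real.pi : ℝ) : ℂ)) * ∫ θ : ℝ,
        Complex.exp (Complex.I * ((n / √t : ℝ) : ℂ) * θ) *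
          (Real.exp (-(1 : ℝ) * θ ^ 2) : ℂ) := by
  have hpi := Real.pi_pos
  have h := fourierIntegral_gaussian (b := 1) (by simp) ((n / √t : ℝ) : ℂ)
  have hc : (1 : ℝ) / √(4 * Real.pi) = 1 / (2 * Real.pi) * √Real.pi := by
    rw [Real.sqrt_mul (by norm_num), show √(4 : ℝ) = 2 by
      rw [show (4 : ℝ) = 2 ^ 2 by norm_num]; exact Real.sqrt_sq (by norm_num)]
    have := Real.mul_self_sqrt hpi.le
    field_simp
    nlinarith
  have he : ∀ θ : ℝ, (Real.exp (-(1 : ℝ) * θ ^ 2) : ℂ) = Complex.exp (-1 * (θ : ℂ) ^ 2) :=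
    fun θ => by push_cast; rfl
  simp only [he]
  rw [h, hc, div_one, Complex.ofReal_mul, Complex.ofReal_mul, mul_assoc]
  have hsq : ((Real.pi : ℂ)) ^ (1 / 2 : ℂ) = ((√Real.pi : ℝ) : ℂ) := by
    rw [Real.sqrt_eq_rpow, Complex.ofReal_cpow hpi.le]
    norm_num
  rw [hsq]
  have hx : -((n : ℝ) ^ 2 / (4 * t)) = -(n / √t) ^ 2 / (4 * 1) := by
    rw [div_pow, Real.sq_sqrt ht.le]
    field_simp
  rw [hx]
  push_cast
  rfl

/-- Both terms are Fourier integrals against the same unimodular wave, so their difference is at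
most the `L¹` distance of the weights. The bound does not involve `n`; this uniformity allows the
lattice point to move with `t`. -/
theorem abs_sqrt_mul_heat_sub_le {t : ℝ} (ht : 0 < t) (n : ℤ) :
    |√t * heat t n - 1 / √(4 * Real.pi) * Real.exp (-((n : ℝ) ^ 2 / (4 * t)))|
      ≤ ∫ θ, |scaledWeight t θ - Real.exp (-(1 : ℝ) * θ ^ 2)| := by
  have hpi := Real.pi_gt_three
  have hn : ∀ θ : ℝ, ‖Complex.exp (Complex.I * ((n / √t : ℝ) : ℂ) * θ)‖ = 1 := fun θ => by
    rw [mul_assoc, ← Complex.ofReal_mul, mul_comm, Complex.norm_exp_ofReal_mul_I]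
  have hint : ∀ g : ℝ → ℝ, Integrable g → Integrable fun θ : ℝ =>
      Complex.exp (Complex.I * ((n / √t : ℝ) : ℂ) * θ) * (g θ : ℂ) := fun g hg => by
    refine hg.ofReal.bdd_mul (c := 1) (Continuous.aestronglyMeasurable (by fun_prop)) ?_
    exact ae_of_all _ fun θ => (hn θ).le
  rw [← Real.norm_eq_abs, ← Complex.norm_real, Complex.ofReal_sub, sqrt_mul_heat_eq ht,
    gaussian_eq_integral ht, ← mul_sub, ← integral_sub (hint _ (integrable_scaledWeight ht))
      (hint _ (integrable_exp_neg_mul_sq one_pos)), norm_mul]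
  have h1 : ‖(1 / ((2 * Real.pi : ℝ) : ℂ))‖ ≤ 1 := by
    rw [norm_div, norm_one, Complex.norm_real, Real.norm_of_nonneg (by linarith),
      div_le_one (by linarith)]
    linarith
  refine (mul_le_of_le_one_left (norm_nonneg _) h1).trans ?_
  refine (norm_integral_le_integral_norm _).trans (le_of_eq ?_)
  congr 1
  funext θ
  rw [← mul_sub, norm_mul, hn, one_mul, ← Complex.ofReal_sub, Complex.norm_real,
    Real.norm_eq_abs]

/-! ### Plane waves and matrix elements of polynomials in the Laplacian -/

/-- The plane wave `e^{i z·k}`. -/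
noncomputable def planeWave {d : ℕ} (z : Fin d → ℤ) (k : Fin d → ℝ) : ℂ :=
  Complex.exp (Complex.I * ((∑ j, (z j : ℝ) * k j : ℝ) : ℂ))

theorem planeWave_eq_prod {d : ℕ} (z : Fin d → ℤ) (k : Fin d → ℝ) :
    planeWave z k = ∏ j, Complex.exp (Complex.I * ((z j * k j : ℝ) : ℂ)) := by
  rw [planeWave, Complex.ofReal_sum, Finset.mul_sum, Complex.exp_sum]

theorem norm_planeWave {d : ℕ} (z : Fin d → ℤ) (k : Fin d → ℝ) : ‖planeWave z k‖ = 1 := by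
  rw [planeWave, mul_comm, Complex.norm_exp_ofReal_mul_I]

theorem continuous_planeWave {d : ℕ} (z : Fin d → ℤ) : Continuous (planeWave z) := by
  unfold planeWave
  fun_prop

theorem continuous_symbol {d : ℕ} : Continuous (symbol (d := d)) := by
  unfold symbol
  fun_prop

theorem symbol_nonneg {d : ℕ} (k : Fin d → ℝ) : 0 ≤ symbol k :=
  Finset.sum_nonneg fun j _ => by linarith [Real.cos_le_one (k j)]

theorem symbol_le {d : ℕ} (k : Fin d → ℝ) : symbol k ≤ 4 * d := by
  have h : symbol k ≤ ∑ _j : Fin d, (4 : ℝ) :=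
    Finset.sum_le_sum fun j _ => by linarith [Real.neg_one_le_cos (k j)]
  simpa [mul_comm] using h

theorem planeWave_add {d : ℕ} (z w : Fin d → ℤ) (k : Fin d → ℝ) :
    planeWave (z + w) k = planeWave z k * planeWave w k := by
  rw [planeWave, planeWave, planeWave, ← Complex.exp_add, ← mul_add, ← Complex.ofReal_add,
    ← Finset.sum_add_distrib]
  congr 3
  refine Finset.sum_congr rfl fun j _ => ?_
  rw [Pi.add_apply]
  push_cast
  ring

theorem planeWave_single {d : ℕ} (j : Fin d) (n : ℤ) (k : Fin d → ℝ) :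
    planeWave (Pi.single j n) k = Complex.exp (n * k j * Complex.I) := by
  rw [planeWave, Finset.sum_eq_single j]
  · rw [Pi.single_eq_same]
    push_cast
    ring_nf
  · intro i _ hij
    rw [Pi.single_eq_of_ne hij]
    simp
  · simp

/-- Plane waves diagonalise `-Δ`, the symbol being the eigenvalue. -/
theorem planeWave_mul_symbol {d : ℕ} (z : Fin d → ℤ) (k : Fin d → ℝ) :
    planeWave z k * (symbol k : ℂ) = ∑ j : Fin d, (2 * planeWave z k
      - planeWave (z + Pi.single j 1) k - planeWave (z - Pi.single j 1) k) := by
  rw [symbol, Complex.ofReal_sum, Finset.mul_sum]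
  refine Finset.sum_congr rfl fun j _ => ?_
  rw [sub_eq_add_neg z, ← Pi.single_neg, planeWave_add, planeWave_add, planeWave_single,
    planeWave_single]
  push_cast
  rw [Complex.cos]
  ring_nf

theorem measurableSet_zone (d : ℕ) : MeasurableSet (zone d) := measurableSet_Icc

theorem isCompact_zone (d : ℕ) : IsCompact (zone d) := isCompact_Icc

theorem restrict_zone (d : ℕ) : (volume : Measure (Fin d → ℝ)).restrict (zone d)
    = Measure.pi fun _ => volume.restrict (Set.Icc (-Real.pi) Real.pi) := by
  rw [← Measure.restrict_pi_pi, Set.pi_univ_Icc]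
  rfl

theorem volume_real_zone (d : ℕ) : volume.real (zone d) = (2 * Real.pi) ^ d := by
  have hpi := Real.pi_pos
  rw [measureReal_def, zone, Real.volume_Icc_pi_toReal (fun _ => by simp; linarith)]
  simp [two_mul]

theorem volume_zone_lt_top (d : ℕ) : volume (zone d) < ⊤ := (isCompact_zone d).measure_lt_top

/-- The Fourier coefficient of `g ∘ symbol` at the lattice point `z`. -/
noncomputable def symbolCoeff {d : ℕ} (g : ℝ → ℝ) (z : Fin d → ℤ) : ℂ :=
  (1 / ((2 * Real.pi : ℝ) : ℂ) ^ d) *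
    ∫ k in zone d, planeWave z k * (g (symbol k) : ℂ)

theorem integrableOn_planeWave_mul {d : ℕ} {g : ℝ → ℝ} (hg : ContinuousOn g (Set.Ici 0))
    (z : Fin d → ℤ) :
    IntegrableOn (fun k => planeWave z k * (g (symbol k) : ℂ)) (zone d) := by
  refine ContinuousOn.integrableOn_compact (isCompact_zone d) (Continuous.continuousOn ?_)
  exact (continuous_planeWave z).mul
    (Complex.continuous_ofReal.comp (hg.comp_continuous continuous_symbol symbol_nonneg))

theorem norm_const_two_pi (d : ℕ) :
    ‖1 / ((2 * Real.pi : ℝ) : ℂ) ^ d‖ = 1 / (2 * Real.pi) ^ d := by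
  rw [norm_div, norm_one, norm_pow, Complex.norm_real,
    Real.norm_of_nonneg (by positivity)]

theorem norm_symbolCoeff_sub_le {d : ℕ} {g h : ℝ → ℝ} (hg : ContinuousOn g (Set.Ici 0))
    (hh : ContinuousOn h (Set.Ici 0)) {ε : ℝ}
    (H : ∀ t ∈ Set.Icc (0 : ℝ) (4 * d), |g t - h t| ≤ ε) (z : Fin d → ℤ) :
    ‖symbolCoeff g z - symbolCoeff h z‖ ≤ ε := by
  have hpi := Real.pi_pos
  rw [symbolCoeff, symbolCoeff, ← mul_sub, ← integral_sub (integrableOn_planeWave_mul hg z)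
    (integrableOn_planeWave_mul hh z), norm_mul, norm_const_two_pi]
  have := norm_setIntegral_le_of_norm_le_const (μ := volume) (volume_zone_lt_top d)
    (f := fun k => planeWave z k * (g (symbol k) : ℂ) - planeWave z k * (h (symbol k) : ℂ))
    (C := ε) (fun k _ => by
      rw [← mul_sub, norm_mul, norm_planeWave, one_mul, ← Complex.ofReal_sub, Complex.norm_real]
      exact H _ ⟨symbol_nonneg k, symbol_le k⟩)
  rw [volume_real_zone] at this
  rw [one_div, inv_mul_le_iff₀ (by positivity), mul_comm]
  exact this

theorem integral_planeWave {d : ℕ} (z : Fin d → ℤ) :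
    ∫ k in zone d, planeWave z k = if z = 0 then ((2 * Real.pi : ℝ) : ℂ) ^ d else 0 := by
  have hpi := Real.pi_pos
  have h1 : ∀ n : ℤ, ∫ k in Set.Icc (-Real.pi) Real.pi,
      Complex.exp (Complex.I * ((n * k : ℝ) : ℂ))
        = if n = 0 then ((2 * Real.pi : ℝ) : ℂ) else 0 := by
    intro n
    -- At `t = 0` the weight is `1`, so this reduces the exponential integral to the cosine one.
    have h := heat_ofReal 0 n
    simp only [zero_mul, neg_zero, Real.exp_zero, Complex.ofReal_one, mul_one] at h
    rw [integral_Icc_eq_integral_Ioc, ← intervalIntegral.integral_of_le (by linarith)]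
    rw [heat] at h
    simp only [zero_mul, neg_zero, Real.exp_zero, mul_one] at h
    rw [integral_cos_int_mul, one_div (((2 * Real.pi : ℝ) : ℂ)), eq_comm,
      inv_mul_eq_iff_eq_mul₀ (by exact_mod_cast (by positivity : (2 * Real.pi : ℝ) ≠ 0))] at h
    rw [h, ← Complex.ofReal_mul]
    split_ifs
    · congr 1
      field_simp
    · simp
  simp only [planeWave_eq_prod]
  rw [restrict_zone, integral_fintype_prod_eq_prod
    (fun j k => Complex.exp (Complex.I * ((z j * k : ℝ) : ℂ)))]
  simp only [h1]
  split_ifs with h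
  · subst h
    simp
  · obtain ⟨j, hj⟩ := Function.ne_iff.1 h
    exact Finset.prod_eq_zero (Finset.mem_univ j) (if_neg hj)

theorem entry_add {d : ℕ} (A B : L2 d →L[ℂ] L2 d) (x y : Fin d → ℤ) :
    entry (A + B) x y = entry A x y + entry B x y := rfl

theorem entry_sub {d : ℕ} (A B : L2 d →L[ℂ] L2 d) (x y : Fin d → ℤ) :
    entry (A - B) x y = entry A x y - entry B x y := rfl

theorem entry_smul {d : ℕ} (a : ℂ) (A : L2 d →L[ℂ] L2 d) (x y : Fin d → ℤ) :
    entry (a • A) x y = a * entry A x y := rfl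

theorem norm_entry_le {d : ℕ} (A : L2 d →L[ℂ] L2 d) (x y : Fin d → ℤ) :
    ‖entry A x y‖ ≤ ‖A‖ := by
  rw [entry_eq_inner]
  refine (norm_inner_le_norm _ _).trans ?_
  rw [lp.norm_single (by norm_num), norm_one, one_mul]
  refine (A.le_opNorm _).trans ?_
  rw [lp.norm_single (by norm_num), norm_one, mul_one]

theorem entry_pow_negLaplacian {d : ℕ} (n : ℕ) (x y : Fin d → ℤ) :
    entry (negLaplacian d ^ n) x y = symbolCoeff (fun t => t ^ n) (x - y) := by
  induction n generalizing x with
  | zero =>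
    have hpi : ((2 * Real.pi : ℝ) : ℂ) ^ d ≠ 0 :=
      pow_ne_zero _ (by exact_mod_cast (by positivity : (2 * Real.pi : ℝ) ≠ 0))
    simp only [pow_zero, symbolCoeff, Complex.ofReal_one, mul_one, integral_planeWave, entry,
      sub_eq_zero]
    rw [one_apply_eq_self, lp.single_apply]
    split_ifs with h
    · subst h
      simp
    · simp [h]
  | succ n ih =>
    have h1 : entry (negLaplacian d ^ (n + 1)) x y = ∑ j : Fin d,
        (2 * entry (negLaplacian d ^ n) x y - entry (negLaplacian d ^ n) (x + Pi.single j 1) y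
        - entry (negLaplacian d ^ n) (x - Pi.single j 1) y) := by
      rw [entry, pow_succ', mul_apply_eq_comp, negLaplacian_apply]
      rfl
    have hi : ∀ z : Fin d → ℤ, Integrable (fun k => planeWave z k * (((symbol k) ^ n : ℝ) : ℂ))
        (volume.restrict (zone d)) := fun z =>
      integrableOn_planeWave_mul (g := fun t => t ^ n) (by fun_prop) z
    have hf : ∀ k : Fin d → ℝ, planeWave (x - y) k * (((symbol k) ^ (n + 1) : ℝ) : ℂ)
        = ∑ j : Fin d, (2 * (planeWave (x - y) k * (((symbol k) ^ n : ℝ) : ℂ))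
          - planeWave (x + Pi.single j 1 - y) k * (((symbol k) ^ n : ℝ) : ℂ)
          - planeWave (x - Pi.single j 1 - y) k * (((symbol k) ^ n : ℝ) : ℂ)) := fun k => by
      have := planeWave_mul_symbol (x - y) k
      rw [pow_succ, mul_comm (symbol k ^ n), Complex.ofReal_mul, ← mul_assoc, this,
        Finset.sum_mul]
      refine Finset.sum_congr rfl fun j _ => ?_
      rw [add_sub_right_comm x, sub_right_comm x]
      ring
    rw [h1, symbolCoeff]
    simp only [hf]
    rw [integral_finsetSum, Finset.mul_sum]
    swap
    · exact fun j _ => (((hi _).const_mul 2).sub (hi _)).sub (hi _)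
    refine Finset.sum_congr rfl fun j _ => ?_
    rw [integral_sub, integral_sub, integral_const_mul, ih, ih, ih]
    rotate_left
    · exact (hi _).const_mul 2
    · exact hi _
    · exact ((hi _).const_mul 2).sub (hi _)
    · exact hi _
    simp only [symbolCoeff]
    ring

theorem entry_aeval_negLaplacian {d : ℕ} (q : Polynomial ℝ) (x y : Fin d → ℤ) :
    entry (Polynomial.aeval (negLaplacian d) (q.map (algebraMap ℝ ℂ))) x y
      = symbolCoeff (fun t => q.eval t) (x - y) := by
  induction q using Polynomial.induction_on' with
  | add p q hp hq =>
    rw [Polynomial.map_add, map_add, entry_add, hp, hq]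
    simp only [symbolCoeff, Polynomial.eval_add, Complex.ofReal_add, mul_add]
    rw [integral_add, mul_add]
    · exact integrableOn_planeWave_mul (g := fun t => p.eval t) (by fun_prop) _
    · exact integrableOn_planeWave_mul (g := fun t => q.eval t) (by fun_prop) _
  | monomial n a =>
    rw [Polynomial.map_monomial, Polynomial.aeval_monomial, ← Algebra.smul_def, entry_smul,
      entry_pow_negLaplacian]
    simp only [symbolCoeff, Polynomial.eval_monomial, Complex.ofReal_mul]
    rw [mul_left_comm, ← integral_const_mul]
    congr 2
    funext k
    rw [Complex.coe_algebraMap]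
    ring

/-! ### Functional calculus and the massive resolvent -/

/-- With `T_j` the unitary shift, `-Δ = ∑ (1 - T_j)* (1 - T_j)`. -/
theorem isPositive_negLaplacian (d : ℕ) : (negLaplacian d).IsPositive := by
  have h : negLaplacian d = ∑ j : Fin d,
      ContinuousLinearMap.adjoint (ContinuousLinearMap.id ℂ (L2 d) - translate (Pi.single j 1)) ∘L
        (ContinuousLinearMap.id ℂ (L2 d) - translate (Pi.single j 1)) := by
    rw [negLaplacian]
    refine Finset.sum_congr rfl fun j _ => ?_
    rw [map_sub, adjoint_translate, ContinuousLinearMap.adjoint_id]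
    ext ψ x
    simp only [sub_apply, ContinuousLinearMap.comp_apply, ContinuousLinearMap.id_apply,
      lp.coeFn_sub, Pi.sub_apply, translate_apply, smul_apply, lp.coeFn_smul,
      Pi.smul_apply, smul_eq_mul, map_sub, neg_add_cancel_right]
    ring
  rw [h]
  refine ContinuousLinearMap.isPositive_sum _ fun j _ => ?_
  exact ContinuousLinearMap.isPositive_adjoint_comp_self _

section PositiveOperator

variable {H : Type*} [NormedAddCommGroup H] [InnerProductSpace ℂ H] [CompleteSpace H]

theorem spectrum_nonneg_of_isPositive {A : H →L[ℂ] H} (hA : A.IsPositive) {t : ℝ}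
    (ht : t ∈ spectrum ℝ A) : 0 ≤ t :=
  (SpectrumRestricts.nnreal_iff.1 hA.spectrumRestricts) t ht

theorem opPow_add_eq_cfc {A : H →L[ℂ] H} (hA : A.IsPositive) {α : ℝ} (hα : 0 < α) (m : ℝ) :
    opPow A α + ((m : ℂ) ^ 2) • ContinuousLinearMap.id ℂ H
      = cfc (fun t : ℝ => t ^ α + m ^ 2) A := by
  have hsa : IsSelfAdjoint A := hA.isSelfAdjoint
  rw [cfc_add_const (m ^ 2) (fun t : ℝ => t ^ α) A
    (Real.continuous_rpow_const hα.le).continuousOn, opPow]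
  congr 1
  rw [Algebra.algebraMap_eq_smul_one, ← Complex.coe_smul]
  push_cast
  rfl

theorem rpow_add_sq_ne_zero {α m : ℝ} (hm : 0 < m) {t : ℝ} (ht : 0 ≤ t) :
    t ^ α + m ^ 2 ≠ 0 := by
  have := Real.rpow_nonneg ht α
  positivity

theorem continuousOn_inv_rpow_add_sq {α m : ℝ} (hα : 0 < α) (hm : 0 < m) :
    ContinuousOn (fun t : ℝ => (t ^ α + m ^ 2)⁻¹) (Set.Ici 0) :=
  ((Real.continuous_rpow_const hα.le).add continuous_const).continuousOn.inv₀
    fun _ ht => rpow_add_sq_ne_zero hm ht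

theorem isUnit_opPow_add {A : H →L[ℂ] H} (hA : A.IsPositive) {α m : ℝ} (hα : 0 < α)
    (hm : 0 < m) : IsUnit (opPow A α + ((m : ℂ) ^ 2) • ContinuousLinearMap.id ℂ H) := by
  have hsa : IsSelfAdjoint A := hA.isSelfAdjoint
  rw [opPow_add_eq_cfc hA hα]
  exact (isUnit_cfc_iff (fun t : ℝ => t ^ α + m ^ 2) A
    ((Real.continuous_rpow_const hα.le).add continuous_const).continuousOn).2
    fun t ht => rpow_add_sq_ne_zero hm (spectrum_nonneg_of_isPositive hA ht)

/-- The resolvent of `A^α` is approximated by polynomials in `A`, simultaneously in operator norm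
and uniformly on a given compact interval. -/
theorem exists_polynomial_near_inverse {A : H →L[ℂ] H} (hA : A.IsPositive) {α m : ℝ}
    (hα : 0 < α) (hm : 0 < m) (R : ℝ) {ε : ℝ} (hε : 0 < ε) :
    ∃ p : Polynomial ℝ, (∀ t ∈ Set.Icc 0 R, |p.eval t - (t ^ α + m ^ 2)⁻¹| ≤ ε) ∧
      ‖Ring.inverse (opPow A α + ((m : ℂ) ^ 2) • ContinuousLinearMap.id ℂ H)
        - Polynomial.aeval A (p.map (algebraMap ℝ ℂ))‖ ≤ ε := by
  have hsa : IsSelfAdjoint A := hA.isSelfAdjoint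
  have hsub : spectrum ℝ A ⊆ Set.Ici 0 := fun t => spectrum_nonneg_of_isPositive hA
  have hg := continuousOn_inv_rpow_add_sq hα hm
  -- The interval is long enough to contain both `[0, R]` and the spectrum of `A`.
  obtain ⟨p, hp⟩ := exists_polynomial_near_of_continuousOn 0
    (max R (‖A‖ * ‖(1 : H →L[ℂ] H)‖)) _ (hg.mono Set.Icc_subset_Ici_self) ε hε
  refine ⟨p, fun t ht => (hp t ⟨ht.1, ht.2.trans (le_max_left _ _)⟩).le, ?_⟩
  rw [Polynomial.aeval_map_algebraMap, ← cfc_polynomial p A, opPow_add_eq_cfc hA hα,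
    ← cfc_inv _ _ (fun t ht => rpow_add_sq_ne_zero hm (hsub ht))
      ((Real.continuous_rpow_const hα.le).add continuous_const).continuousOn,
    ← cfc_sub _ _ _ (hg.mono hsub) (by fun_prop)]
  refine norm_cfc_le hε.le fun t ht => ?_
  rw [Real.norm_eq_abs, abs_sub_comm]
  refine (hp t ⟨hsub ht, le_max_of_le_right ?_⟩).le
  exact (le_abs_self t).trans (spectrum.norm_le_norm_mul_of_mem ht)

end PositiveOperator

theorem isUnit_massiveOp {d : ℕ} {α m : ℝ} (hα : 0 < α) (hm : 0 < m) :
    IsUnit (massiveOp d α m) :=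
  isUnit_opPow_add (isPositive_negLaplacian d) hα hm

/-- One polynomial approximates the resolvent in norm and its symbol uniformly on `[0, 4d]`, which
contains the range of the symbol. The two sides therefore differ by less than any `ε`, and the
spectrum of `-Δ` need not be computed. -/
theorem massiveGreen_eq {d : ℕ} {α m : ℝ} (hα : 0 < α) (hm : 0 < m) (x y : Fin d → ℤ) :
    massiveGreen d α m x y = symbolCoeff (fun t => (t ^ α + m ^ 2)⁻¹) (x - y) := by
  rw [← sub_eq_zero, ← norm_le_zero_iff]
  refine le_of_forall_pos_le_add fun ε hε => ?_
  obtain ⟨p, hp, hpA⟩ := exists_polynomial_near_inverse (isPositive_negLaplacian d) hα hm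
    (4 * d) (half_pos hε)
  have h1 := (norm_entry_le _ x y).trans hpA
  rw [entry_sub, entry_aeval_negLaplacian] at h1
  have h2 : ‖symbolCoeff (fun t => p.eval t) (x - y)
      - symbolCoeff (fun t => (t ^ α + m ^ 2)⁻¹) (x - y)‖ ≤ ε / 2 :=
    norm_symbolCoeff_sub_le (by fun_prop) (continuousOn_inv_rpow_add_sq hα hm) hp _
  refine (norm_sub_le_norm_sub_add_norm_sub _ (symbolCoeff (fun t => p.eval t) (x - y)) _).trans ?_
  refine (add_le_add h1 h2).trans (le_of_eq ?_)
  ring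

/-! ### Heat kernel on `ℤ^d` and the Green function as its time integral -/

/-- The heat kernel `e^{tΔ}(0, z)` on `ℤ^d`. -/
noncomputable def latticeHeat {d : ℕ} (t : ℝ) (z : Fin d → ℤ) : ℝ := ∏ j, heat t (z j)

theorem continuous_heat (n : ℤ) : Continuous fun t => heat t n := by
  unfold heat
  refine continuous_const.mul ?_
  exact intervalIntegral.continuous_parametric_intervalIntegral_of_continuous'
    (by simp only [Function.uncurry_def]; fun_prop) _ _

theorem continuous_latticeHeat {d : ℕ} (z : Fin d → ℤ) : Continuous fun t => latticeHeat t z :=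
  continuous_finsetProd _ fun j _ => continuous_heat (z j)

theorem latticeHeat_pos {d : ℕ} {t : ℝ} (ht : 0 < t) (z : Fin d → ℤ) : 0 < latticeHeat t z :=
  Finset.prod_pos fun j _ => heat_pos ht (z j)

theorem latticeHeat_le {d : ℕ} {t : ℝ} (ht : 0 < t) (z : Fin d → ℤ) :
    latticeHeat t z ≤ (2 / √(1 + t)) ^ d := by
  have h := Finset.prod_le_prod (s := Finset.univ) (f := fun j => heat t (z j))
    (g := fun _ : Fin d => 2 / √(1 + t)) (fun j _ => (heat_pos ht (z j)).le)
    (fun j _ => (le_abs_self _).trans ((abs_heat_le t (z j)).trans (heat_zero_le ht.le)))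
  rwa [Finset.prod_const, Finset.card_univ, Fintype.card_fin] at h

theorem latticeHeat_le_min {d : ℕ} {t : ℝ} (ht : 0 < t) (z : Fin d → ℤ) :
    latticeHeat t z ≤ 2 ^ d * min 1 (t ^ (-((d : ℝ) / 2))) := by
  refine (latticeHeat_le ht z).trans ?_
  rw [div_eq_mul_inv, mul_pow]
  refine mul_le_mul_of_nonneg_left (le_min ?_ ?_) (by positivity)
  · exact pow_le_one₀ (by positivity) (inv_le_one_of_one_le₀ (Real.one_le_sqrt.2 (by linarith)))
  · have h : t ^ (-((d : ℝ) / 2)) = (√t)⁻¹ ^ d := by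
      rw [Real.sqrt_eq_rpow, ← Real.rpow_neg ht.le, ← Real.rpow_natCast, ← Real.rpow_mul ht.le]
      ring_nf
    rw [h]
    have := Real.sqrt_pos.2 ht
    gcongr
    linarith

/-- An integrable majorant for the time integral of the heat kernel. -/
noncomputable def majorant (d : ℕ) (α s : ℝ) : ℝ := s ^ (α - 1) * min 1 (s ^ (-((d : ℝ) / 2)))

theorem measurable_majorant (d : ℕ) (α : ℝ) : Measurable (majorant d α) := by
  unfold majorant
  fun_prop

/-- Near `0` the power `s^{α-1}` is integrable because `α > 0`; near infinity `s^{α-1-d/2}` is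
because `α < d/2`. -/
theorem integrableOn_majorant {d : ℕ} {α : ℝ} (hα : 0 < α) (hαd : α < (d : ℝ) / 2) :
    IntegrableOn (majorant d α) (Set.Ioi 0) := by
  have hm := measurable_majorant d α
  rw [← Set.Ioc_union_Ioi_eq_Ioi zero_le_one, integrableOn_union]
  constructor
  · have h1 : IntegrableOn (fun s : ℝ => s ^ (α - 1)) (Set.Ioc 0 1) :=
      (intervalIntegrable_iff_integrableOn_Ioc_of_le zero_le_one).1
        (intervalIntegral.intervalIntegrable_rpow' (by linarith))
    refine h1.mono' hm.aestronglyMeasurable ?_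
    refine (ae_restrict_iff' measurableSet_Ioc).2 (ae_of_all _ fun s hs => ?_)
    have h0 : 0 ≤ s ^ (α - 1) := Real.rpow_nonneg hs.1.le _
    have h2 : 0 ≤ s ^ (-((d : ℝ) / 2)) := Real.rpow_nonneg hs.1.le _
    rw [majorant, Real.norm_of_nonneg (by positivity)]
    exact mul_le_of_le_one_right h0 (min_le_left _ _)
  · have h1 : IntegrableOn (fun s : ℝ => s ^ (α - 1 - (d : ℝ) / 2)) (Set.Ioi 1) :=
      integrableOn_Ioi_rpow_of_lt (by linarith) one_pos
    refine h1.mono' hm.aestronglyMeasurable ?_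
    refine (ae_restrict_iff' measurableSet_Ioi).2 (ae_of_all _ fun s hs => ?_)
    have hs0 : 0 < s := zero_lt_one.trans hs
    have h0 : 0 ≤ s ^ (α - 1) := Real.rpow_nonneg hs0.le _
    have h2 : 0 ≤ s ^ (-((d : ℝ) / 2)) := Real.rpow_nonneg hs0.le _
    rw [majorant, Real.norm_of_nonneg (by positivity), sub_eq_add_neg (α - 1),
      Real.rpow_add hs0]
    exact mul_le_mul_of_nonneg_left (min_le_right _ _) h0

theorem integrableOn_rpow_mul_latticeHeat {d : ℕ} {α : ℝ} (hα : 0 < α)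
    (hαd : α < (d : ℝ) / 2) (z : Fin d → ℤ) :
    IntegrableOn (fun t => t ^ (α - 1) * latticeHeat t z) (Set.Ioi 0) := by
  refine ((integrableOn_majorant hα hαd).const_mul (2 ^ d)).mono' ?_ ?_
  · have := (continuous_latticeHeat z).measurable
    exact Measurable.aestronglyMeasurable (by fun_prop)
  · refine (ae_restrict_iff' measurableSet_Ioi).2 (ae_of_all _ fun t ht => ?_)
    have h0 := (latticeHeat_pos ht z).le
    have h1 : 0 ≤ t ^ (α - 1) := Real.rpow_nonneg (le_of_lt ht) _
    rw [Real.norm_of_nonneg (by positivity), majorant, mul_left_comm]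
    exact mul_le_mul_of_nonneg_left (latticeHeat_le_min ht z) h1

/-- The Green function of the fractional Laplacian as a time integral of the heat kernel. -/
noncomputable def greenFn {d : ℕ} (α : ℝ) (z : Fin d → ℤ) : ℝ :=
  1 / Real.Gamma α * ∫ t in Set.Ioi 0, t ^ (α - 1) * latticeHeat t z

theorem greenFn_pos {d : ℕ} {α : ℝ} (hα : 0 < α) (hαd : α < (d : ℝ) / 2) (z : Fin d → ℤ) :
    0 < greenFn α z := by
  refine mul_pos (one_div_pos.2 (Real.Gamma_pos_of_pos hα)) ?_
  have hpos : ∀ t ∈ Set.Ioi (0 : ℝ), 0 < t ^ (α - 1) * latticeHeat t z := fun t ht =>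
    mul_pos (Real.rpow_pos_of_pos ht _) (latticeHeat_pos ht z)
  rw [setIntegral_pos_iff_support_of_nonneg_ae
    ((ae_restrict_iff' measurableSet_Ioi).2 (ae_of_all _ fun t ht => (hpos t ht).le))
    (integrableOn_rpow_mul_latticeHeat hα hαd z)]
  have : Function.support (fun t : ℝ => t ^ (α - 1) * latticeHeat t z) ∩ Set.Ioi 0
      = Set.Ioi 0 := Set.inter_eq_right.2 fun t ht => (hpos t ht).ne'
  rw [this]
  simp

/-! ### Fourier representation and the massless limit -/

theorem integral_planeWave_mul_exp {d : ℕ} (t : ℝ) (z : Fin d → ℤ) :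
    ∫ k in zone d, planeWave z k * (Real.exp (-(t * symbol k)) : ℂ)
      = ((2 * Real.pi : ℝ) : ℂ) ^ d * (latticeHeat t z : ℂ) := by
  have hpi := Real.pi_pos
  have h1 : ∀ k : Fin d → ℝ, planeWave z k * (Real.exp (-(t * symbol k)) : ℂ)
      = ∏ j, (Complex.exp (Complex.I * ((z j * k j : ℝ) : ℂ)) *
        (Real.exp (-(t * (2 * (1 - Real.cos (k j))))) : ℂ)) := fun k => by
    rw [Finset.prod_mul_distrib, ← planeWave_eq_prod, ← Complex.ofReal_prod, ← Real.exp_sum,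
      Finset.sum_neg_distrib, ← Finset.mul_sum, symbol]
  simp only [h1]
  rw [restrict_zone, integral_fintype_prod_eq_prod
    (fun j k => Complex.exp (Complex.I * ((z j * k : ℝ) : ℂ)) *
        (Real.exp (-(t * (2 * (1 - Real.cos k)))) : ℂ)), latticeHeat, Complex.ofReal_prod]
  have h2 : ((2 * Real.pi : ℝ) : ℂ) ≠ 0 := by
    exact_mod_cast (by positivity : (2 * Real.pi : ℝ) ≠ 0)
  have h3 : ((2 * Real.pi : ℝ) : ℂ) ^ d = ∏ _j : Fin d, ((2 * Real.pi : ℝ) : ℂ) := by simp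
  rw [h3, ← Finset.prod_mul_distrib]
  refine Finset.prod_congr rfl fun j _ => ?_
  rw [heat_ofReal, ← mul_assoc, mul_one_div_cancel h2, one_mul, integral_Icc_eq_integral_Ioc,
    ← intervalIntegral.integral_of_le (by linarith)]

/-- Inside the zone the symbol vanishes only at the origin, a null set once `d > 0`. -/
theorem ae_symbol_pos {d : ℕ} (hd : 0 < d) :
    ∀ᵐ k ∂((volume : Measure (Fin d → ℝ)).restrict (zone d)), 0 < symbol k := by
  have : Nonempty (Fin d) := ⟨⟨0, hd⟩⟩
  have h0 : ∀ᵐ k ∂(volume : Measure (Fin d → ℝ)), k ≠ 0 := by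
    rw [ae_iff]
    simp
  refine (ae_restrict_iff' (measurableSet_zone d)).2 ?_
  filter_upwards [h0] with k hk hz
  obtain ⟨j, hj⟩ := Function.ne_iff.1 hk
  have h1 := two_mul_one_sub_cos_ge (abs_le.2 ⟨hz.1 j, hz.2 j⟩)
  have h2 : 0 < 4 / Real.pi ^ 2 * k j ^ 2 := by
    have : k j ≠ 0 := hj
    positivity
  refine (h2.trans_le h1).trans_le ?_
  exact Finset.single_le_sum (f := fun j => 2 * (1 - Real.cos (k j)))
    (fun i _ => by linarith [Real.cos_le_one (k i)]) (Finset.mem_univ j)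

theorem fourierIntegrand_eq {d : ℕ} (α : ℝ) (z : Fin d → ℤ) (k : Fin d → ℝ) :
    fourierIntegrand α z k = planeWave z k * (((symbol k ^ α)⁻¹ : ℝ) : ℂ) := by
  rw [fourierIntegrand, planeWave, div_eq_mul_inv, Complex.ofReal_inv]

theorem integral_rpow_mul_exp_mul_planeWave {d : ℕ} {α : ℝ} (hα : 0 < α) (z : Fin d → ℤ)
    {k : Fin d → ℝ} (hk : 0 < symbol k) :
    ∫ t in Set.Ioi (0 : ℝ), planeWave z k * ((t ^ (α - 1) * Real.exp (-(t * symbol k)) : ℝ) : ℂ)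
      = (Real.Gamma α : ℂ) * fourierIntegrand α z k := by
  have h : ∫ t in Set.Ioi (0 : ℝ), t ^ (α - 1) * Real.exp (-(t * symbol k))
      = (symbol k ^ α)⁻¹ * Real.Gamma α := by
    have := Real.integral_rpow_mul_exp_neg_mul_Ioi hα hk
    rw [one_div, Real.inv_rpow hk.le] at this
    rw [← this]
    simp only [mul_comm (symbol k)]
  rw [integral_const_mul, integral_complex_ofReal, h, fourierIntegrand_eq]
  push_cast
  ring

theorem integrable_planeWave_mul_rpow_mul_exp {d : ℕ} {α : ℝ} (hα : 0 < α)
    (hαd : α < (d : ℝ) / 2) (z : Fin d → ℤ) :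
    Integrable (fun p : (Fin d → ℝ) × ℝ =>
        planeWave z p.1 * ((p.2 ^ (α - 1) * Real.exp (-(p.2 * symbol p.1)) : ℝ) : ℂ))
      ((volume.restrict (zone d)).prod (volume.restrict (Set.Ioi 0))) := by
  have hs := continuous_symbol (d := d)
  have hw := continuous_planeWave z
  have hm : AEStronglyMeasurable (fun p : (Fin d → ℝ) × ℝ =>
        planeWave z p.1 * ((p.2 ^ (α - 1) * Real.exp (-(p.2 * symbol p.1)) : ℝ) : ℂ))
      ((volume.restrict (zone d)).prod (volume.restrict (Set.Ioi 0))) := by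
    have h1 := hs.measurable
    have h2 := hw.measurable
    exact Measurable.aestronglyMeasurable (by fun_prop)
  rw [integrable_prod_iff' hm]
  constructor
  · refine ae_of_all _ fun t => ?_
    have he : Continuous fun k : Fin d → ℝ => t ^ (α - 1) * Real.exp (-(t * symbol k)) :=
      continuous_const.mul (by fun_prop)
    exact ContinuousOn.integrableOn_compact (isCompact_zone d)
      (hw.mul (Complex.continuous_ofReal.comp he)).continuousOn
  -- Taking norms removes the plane wave, so the `k`-integral is the heat kernel at `z = 0`,
  -- whatever the original `z`.
  · have h0 := (integrableOn_rpow_mul_latticeHeat hα hαd (0 : Fin d → ℤ)).const_mul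
      ((2 * Real.pi) ^ d)
    refine Integrable.congr h0 ?_
    refine (ae_restrict_iff' measurableSet_Ioi).2 (ae_of_all _ fun t ht => ?_)
    have h1 := integral_planeWave_mul_exp t (0 : Fin d → ℤ)
    have hw0 : ∀ k : Fin d → ℝ, planeWave 0 k = 1 := fun k => by simp [planeWave]
    simp only [hw0, one_mul] at h1
    rw [integral_complex_ofReal] at h1
    have h2 : ∫ k in zone d, Real.exp (-(t * symbol k))
        = (2 * Real.pi) ^ d * latticeHeat t (0 : Fin d → ℤ) := by exact_mod_cast h1
    have h3 : ∀ k : Fin d → ℝ, ‖planeWave z k *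
        ((t ^ (α - 1) * Real.exp (-(t * symbol k)) : ℝ) : ℂ)‖
        = t ^ (α - 1) * Real.exp (-(t * symbol k)) := fun k => by
      rw [norm_mul, norm_planeWave, one_mul, Complex.norm_real, Real.norm_of_nonneg]
      exact mul_nonneg (Real.rpow_nonneg (le_of_lt ht) _) (Real.exp_pos _).le
    simp only [h3]
    rw [integral_const_mul, h2]
    ring

theorem pos_of_lt_half {d : ℕ} {α : ℝ} (hα : 0 < α) (hαd : α < (d : ℝ) / 2) : 0 < d := by
  rcases Nat.eq_zero_or_pos d with h | h
  · subst h
    norm_num at hαd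
    linarith
  · exact h

/-- The integrand is, up to `Γ(α)`, the `t`-marginal of a jointly integrable function, so the
singularity at `k = 0` needs no separate estimate. -/
theorem integrableOn_fourierIntegrand {d : ℕ} {α : ℝ} (hα : 0 < α) (hαd : α < (d : ℝ) / 2)
    (z : Fin d → ℤ) : IntegrableOn (fourierIntegrand α z) (zone d) := by
  have hG : (Real.Gamma α : ℂ) ≠ 0 := by exact_mod_cast (Real.Gamma_pos_of_pos hα).ne'
  have h := (integrable_planeWave_mul_rpow_mul_exp hα hαd z).integral_prod_left.const_mul
    (Real.Gamma α : ℂ)⁻¹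
  refine Integrable.congr h ?_
  filter_upwards [ae_symbol_pos (pos_of_lt_half hα hαd)] with k hk
  rw [integral_rpow_mul_exp_mul_planeWave hα z hk, inv_mul_cancel_left₀ hG]

theorem greenFn_eq_fourier {d : ℕ} {α : ℝ} (hα : 0 < α) (hαd : α < (d : ℝ) / 2)
    (z : Fin d → ℤ) : (greenFn α z : ℂ) = (1 / ((2 * Real.pi : ℝ) : ℂ) ^ d) *
      ∫ k in zone d, fourierIntegrand α z k := by
  have hpi := Real.pi_pos
  have hG : (Real.Gamma α : ℂ) ≠ 0 := by exact_mod_cast (Real.Gamma_pos_of_pos hα).ne'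
  have h2 : ((2 * Real.pi : ℝ) : ℂ) ^ d ≠ 0 :=
    pow_ne_zero _ (by exact_mod_cast (by positivity : (2 * Real.pi : ℝ) ≠ 0))
  have h := integral_integral_swap (f := fun (k : Fin d → ℝ) (t : ℝ) => planeWave z k *
      ((t ^ (α - 1) * Real.exp (-(t * symbol k)) : ℝ) : ℂ))
    (integrable_planeWave_mul_rpow_mul_exp hα hαd z)
  have hl : ∫ k in zone d, ∫ t in Set.Ioi (0 : ℝ), planeWave z k *
      ((t ^ (α - 1) * Real.exp (-(t * symbol k)) : ℝ) : ℂ)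
      = (Real.Gamma α : ℂ) * ∫ k in zone d, fourierIntegrand α z k := by
    rw [← integral_const_mul]
    refine integral_congr_ae ?_
    filter_upwards [ae_symbol_pos (pos_of_lt_half hα hαd)] with k hk
    exact integral_rpow_mul_exp_mul_planeWave hα z hk
  have hr : ∫ t in Set.Ioi (0 : ℝ), ∫ k in zone d, planeWave z k *
      ((t ^ (α - 1) * Real.exp (-(t * symbol k)) : ℝ) : ℂ)
      = ((2 * Real.pi : ℝ) : ℂ) ^ d *
        ((∫ t in Set.Ioi (0 : ℝ), t ^ (α - 1) * latticeHeat t z : ℝ) : ℂ) := by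
    rw [← integral_complex_ofReal, ← integral_const_mul]
    congr 1
    funext t
    have := integral_planeWave_mul_exp t z
    rw [Complex.ofReal_mul (t ^ (α - 1)), mul_left_comm, ← this, ← integral_const_mul]
    congr 1
    funext k
    rw [Complex.ofReal_mul]
    ring
  rw [hl, hr] at h
  rw [greenFn, Complex.ofReal_mul, one_div_mul_eq_div, eq_div_iff h2, Complex.ofReal_div,
    Complex.ofReal_one, one_div, mul_assoc, inv_mul_eq_iff_eq_mul₀ hG, h]
  ring

theorem tendsto_massiveGreen {d : ℕ} {α : ℝ} (hα : 0 < α) (hαd : α < (d : ℝ) / 2)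
    (x y : Fin d → ℤ) :
    Tendsto (fun m : ℝ => massiveGreen d α m x y) (𝓝[>] 0) (𝓝 (greenFn α (x - y) : ℂ)) := by
  have hev : ∀ᶠ m : ℝ in 𝓝[>] 0, 0 < m := eventually_mem_nhdsWithin
  have hd := pos_of_lt_half hα hαd
  have h : Tendsto (fun m : ℝ => symbolCoeff (fun t => (t ^ α + m ^ 2)⁻¹) (x - y)) (𝓝[>] 0)
      (𝓝 (greenFn α (x - y) : ℂ)) := by
    rw [greenFn_eq_fourier hα hαd]
    refine Tendsto.const_mul _ ?_
    refine tendsto_integral_filter_of_dominated_convergence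
      (fun k => ‖fourierIntegrand α (x - y) k‖) ?_ ?_
      (integrableOn_fourierIntegrand hα hαd (x - y)).norm ?_
    · filter_upwards [hev] with m hm
      exact (integrableOn_planeWave_mul (continuousOn_inv_rpow_add_sq hα hm)
        (x - y)).aestronglyMeasurable
    · filter_upwards [hev] with m hm
      filter_upwards [ae_symbol_pos hd] with k hk
      have h0 := Real.rpow_pos_of_pos hk α
      rw [fourierIntegrand_eq, norm_mul, norm_mul, Complex.norm_real, Complex.norm_real,
        Real.norm_of_nonneg (by positivity), Real.norm_of_nonneg (by positivity)]
      gcongr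
      exact le_add_of_nonneg_right (by positivity)
    · filter_upwards [ae_symbol_pos hd] with k hk
      have h0 := Real.rpow_pos_of_pos hk α
      rw [fourierIntegrand_eq]
      refine Tendsto.const_mul _ ((Complex.continuous_ofReal.tendsto _).comp ?_)
      refine Tendsto.inv₀ ?_ h0.ne'
      have hc : Continuous fun m : ℝ => symbol k ^ α + m ^ 2 := by fun_prop
      have := hc.tendsto 0
      simp only [ne_eq, OfNat.ofNat_ne_zero, not_false_eq_true, zero_pow, add_zero] at this
      exact this.mono_left nhdsWithin_le_nhds
  refine h.congr' ?_
  filter_upwards [hev] with m hm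
  rw [massiveGreen_eq hα hm]

/-! ### Scaling limit of the heat kernel and the Riesz constant -/

/-- The factors are exchanged one at a time; this carries the one-dimensional limit theorem to `d`
dimensions. -/
theorem abs_prod_sub_prod_le {ι : Type*} (s : Finset ι) (a b : ι → ℝ) {C ε : ℝ} (hC : 1 ≤ C)
    (ha : ∀ i, |a i| ≤ C) (hb : ∀ i, |b i| ≤ C) (hab : ∀ i, |a i - b i| ≤ ε) :
    |∏ i ∈ s, a i - ∏ i ∈ s, b i| ≤ C ^ s.card * s.card * ε := by
  classical
  induction s using Finset.induction_on with
  | empty => simp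
  | insert i s hi ih =>
    have hε : 0 ≤ ε := (abs_nonneg _).trans (hab i)
    have hC0 : 0 ≤ C := by linarith
    have hp : |∏ j ∈ s, b j| ≤ C ^ s.card := by
      rw [Finset.abs_prod, ← Finset.prod_const]
      exact Finset.prod_le_prod (fun j _ => abs_nonneg _) fun j _ => hb j
    rw [Finset.prod_insert hi, Finset.prod_insert hi, Finset.card_insert_of_notMem hi]
    have e : a i * ∏ j ∈ s, a j - b i * ∏ j ∈ s, b j
        = a i * (∏ j ∈ s, a j - ∏ j ∈ s, b j) + (a i - b i) * ∏ j ∈ s, b j := by ring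
    rw [e]
    refine (abs_add_le _ _).trans ?_
    rw [abs_mul, abs_mul]
    have h1 : |a i| * |∏ j ∈ s, a j - ∏ j ∈ s, b j| ≤ C * (C ^ s.card * s.card * ε) :=
      mul_le_mul (ha i) ih (abs_nonneg _) hC0
    have h2 : |a i - b i| * |∏ j ∈ s, b j| ≤ ε * C ^ s.card :=
      mul_le_mul (hab i) hp (abs_nonneg _) hε
    have h3 : ε * C ^ s.card ≤ C ^ (s.card + 1) * ε := by
      rw [mul_comm]
      exact mul_le_mul_of_nonneg_right (pow_le_pow_right₀ hC (Nat.le_succ _)) hε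
    calc _ ≤ C * (C ^ s.card * s.card * ε) + C ^ (s.card + 1) * ε :=
          add_le_add h1 (h2.trans h3)
      _ = _ := by push_cast; ring

theorem euclNorm_sq {d : ℕ} (z : Fin d → ℤ) : euclNorm z ^ 2 = ∑ j, (z j : ℝ) ^ 2 :=
  Real.sq_sqrt (Finset.sum_nonneg fun _ _ => sq_nonneg _)

theorem euclNorm_nonneg {d : ℕ} (z : Fin d → ℤ) : 0 ≤ euclNorm z := Real.sqrt_nonneg _

theorem abs_le_euclNorm {d : ℕ} (z : Fin d → ℤ) (j : Fin d) : |(z j : ℝ)| ≤ euclNorm z := by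
  refine Real.abs_le_sqrt ?_
  exact Finset.single_le_sum (f := fun j => (z j : ℝ) ^ 2) (fun i _ => sq_nonneg _)
    (Finset.mem_univ j)

theorem euclNorm_pos {d : ℕ} {z : Fin d → ℤ} (hz : z ≠ 0) : 0 < euclNorm z := by
  obtain ⟨j, hj⟩ := Function.ne_iff.1 hz
  refine lt_of_lt_of_le ?_ (abs_le_euclNorm z j)
  exact abs_pos.2 (by exact_mod_cast hj)

theorem finite_euclNorm_le {d : ℕ} (R : ℝ) : {z : Fin d → ℤ | euclNorm z ≤ R}.Finite := by
  refine (Set.finite_Icc (fun _ : Fin d => -⌈R⌉) (fun _ => ⌈R⌉)).subset fun z hz => ?_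
  have h : ∀ j, |z j| ≤ ⌈R⌉ := fun j => by
    have h1 := (abs_le_euclNorm z j).trans (le_trans (Set.mem_ofPred.1 hz) (Int.le_ceil R))
    exact_mod_cast h1
  exact ⟨fun j => (abs_le.1 (h j)).1, fun j => (abs_le.1 (h j)).2⟩

theorem exists_euclNorm_le {d : ℕ} (hd : 0 < d) (z : Fin d → ℤ) :
    ∃ j, euclNorm z ≤ √d * |(z j : ℝ)| := by
  have : Nonempty (Fin d) := ⟨⟨0, hd⟩⟩
  obtain ⟨j, hj⟩ := Finite.exists_max fun j => |(z j : ℝ)|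
  refine ⟨j, ?_⟩
  rw [euclNorm, Real.sqrt_le_left (by positivity), mul_pow, Real.sq_sqrt (by positivity), sq_abs]
  have h := Finset.sum_le_sum (s := Finset.univ) (f := fun i => (z i : ℝ) ^ 2)
    (g := fun _ : Fin d => (z j : ℝ) ^ 2) fun i _ => sq_le_sq.2 (hj i)
  simpa using h

/-- A largest coordinate satisfies `|z| ≤ √d |z_j|` and absorbs all of `|z|^d`, costing
`(1+t)^{(d-1)/2}`. The other `d - 1` factors, each at most `2/√(1+t)`, cancel this exactly. -/
theorem exists_euclNorm_pow_mul_latticeHeat_le {d : ℕ} (hd : 0 < d) :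
    ∃ C : ℝ, ∀ (t : ℝ) (z : Fin d → ℤ), 0 < t → euclNorm z ^ d * latticeHeat t z ≤ C := by
  refine ⟨√d ^ d * (Real.exp 2 * 2 * d.factorial * 2 ^ (d - 1)), fun t z ht => ?_⟩
  obtain ⟨j, hj⟩ := exists_euclNorm_le hd z
  have hr : 0 < √(1 + t) := Real.sqrt_pos.2 (by linarith)
  have h1 : euclNorm z ^ d ≤ √d ^ d * |(z j : ℝ)| ^ d := by
    rw [← mul_pow]
    exact pow_le_pow_left₀ (euclNorm_nonneg z) hj d
  have h2 := heat_mul_pow_le ht.le (z j) d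
  have h3 : ∏ i ∈ Finset.univ.erase j, heat t (z i) ≤ (2 / √(1 + t)) ^ (d - 1) := by
    have h := Finset.prod_le_prod (s := Finset.univ.erase j) (f := fun i => heat t (z i))
      (g := fun _ => 2 / √(1 + t)) (fun i _ => (heat_pos ht (z i)).le)
      (fun i _ => (le_abs_self _).trans ((abs_heat_le t (z i)).trans (heat_zero_le ht.le)))
    rwa [Finset.prod_const, Finset.card_erase_of_mem (Finset.mem_univ j), Finset.card_univ,
      Fintype.card_fin] at h
  have h4 : 0 ≤ ∏ i ∈ Finset.univ.erase j, heat t (z i) :=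
    Finset.prod_nonneg fun i _ => (heat_pos ht (z i)).le
  set r := √(1 + t) with hrdef
  calc euclNorm z ^ d * latticeHeat t z
      ≤ (√d ^ d * |(z j : ℝ)| ^ d) * latticeHeat t z :=
        mul_le_mul_of_nonneg_right h1 (latticeHeat_pos ht z).le
    _ = √d ^ d * ((|(z j : ℝ)| ^ d * heat t (z j)) * ∏ i ∈ Finset.univ.erase j, heat t (z i)) := by
        rw [latticeHeat, ← Finset.mul_prod_erase _ _ (Finset.mem_univ j)]
        ring
    _ ≤ √d ^ d * ((Real.exp 2 * 2 * d.factorial * (r ^ d / r)) * (2 / r) ^ (d - 1)) := by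
        refine mul_le_mul_of_nonneg_left ?_ (by positivity)
        exact mul_le_mul h2 h3 h4 (by positivity)
    _ = √d ^ d * (Real.exp 2 * 2 * d.factorial * 2 ^ (d - 1)) := by
        have : r ^ d = r ^ (d - 1) * r := by rw [← pow_succ, Nat.sub_add_cancel hd]
        rw [this, div_pow]
        field_simp

/-- Domination for the scaled integral: spatial decay controls small `s`, decay in time controls
large `s`. -/
theorem exists_scaled_latticeHeat_le {d : ℕ} (hd : 0 < d) :
    ∃ C : ℝ, ∀ (s : ℝ) (z : Fin d → ℤ), 0 < s → z ≠ 0 →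
      euclNorm z ^ d * latticeHeat (euclNorm z ^ 2 * s) z
        ≤ C * min 1 (s ^ (-((d : ℝ) / 2))) := by
  obtain ⟨C, hC⟩ := exists_euclNorm_pow_mul_latticeHeat_le hd
  refine ⟨max C (2 ^ d), fun s z hs hz => ?_⟩
  have hN := euclNorm_pos hz
  have hp := Real.rpow_nonneg hs.le (-((d : ℝ) / 2))
  rcases le_total 1 (s ^ (-((d : ℝ) / 2))) with h | h
  · rw [min_eq_left h, mul_one]
    exact (hC _ z (by positivity)).trans (le_max_left _ _)
  · rw [min_eq_right h]
    have h1 := (latticeHeat_le_min (t := euclNorm z ^ 2 * s) (by positivity) z).trans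
      (mul_le_mul_of_nonneg_left (min_le_right _ _) (by positivity))
    have h2 : (euclNorm z ^ 2 * s) ^ (-((d : ℝ) / 2))
        = (euclNorm z ^ d)⁻¹ * s ^ (-((d : ℝ) / 2)) := by
      rw [Real.mul_rpow (by positivity) hs.le, ← Real.rpow_natCast, ← Real.rpow_mul hN.le,
        ← Real.rpow_natCast, ← Real.rpow_neg hN.le]
      push_cast
      ring_nf
    rw [h2] at h1
    calc _ ≤ euclNorm z ^ d * (2 ^ d * ((euclNorm z ^ d)⁻¹ * s ^ (-((d : ℝ) / 2)))) :=
          mul_le_mul_of_nonneg_left h1 (by positivity)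
      _ = 2 ^ d * s ^ (-((d : ℝ) / 2)) := by field_simp
      _ ≤ _ := mul_le_mul_of_nonneg_right (le_max_right _ _) hp

/-- Substitute `t = |z|² s`; the powers of `|z|` combine to `(d - 2α) + 2 + 2(α - 1) = d`. -/
theorem euclNorm_rpow_mul_greenFn {d : ℕ} (α : ℝ) {z : Fin d → ℤ} (hz : z ≠ 0) :
    euclNorm z ^ ((d : ℝ) - 2 * α) * greenFn α z
      = 1 / Real.Gamma α * ∫ s in Set.Ioi 0, s ^ (α - 1) *
          (euclNorm z ^ d * latticeHeat (euclNorm z ^ 2 * s) z) := by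
  have hN := euclNorm_pos hz
  have h := integral_comp_mul_left_Ioi (fun t => t ^ (α - 1) * latticeHeat t z) 0
    (b := euclNorm z ^ 2) (by positivity)
  rw [mul_zero, smul_eq_mul, eq_inv_mul_iff_mul_eq₀ (by positivity)] at h
  rw [greenFn, ← h, mul_left_comm, ← integral_const_mul, ← integral_const_mul]
  congr 1
  refine setIntegral_congr_fun measurableSet_Ioi fun s hs => ?_
  have h1 : euclNorm z ^ ((d : ℝ) - 2 * α) * euclNorm z ^ 2 * (euclNorm z ^ 2) ^ (α - 1)
      = euclNorm z ^ d := by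
    rw [← Real.rpow_natCast _ 2, ← Real.rpow_mul hN.le, ← Real.rpow_add hN, ← Real.rpow_add hN,
      ← Real.rpow_natCast _ d]
    push_cast
    ring_nf
  rw [Real.mul_rpow (by positivity) (le_of_lt hs), ← h1]
  ring

theorem tendsto_scaled_latticeHeat {d : ℕ} {s : ℝ} (hs : 0 < s) :
    Tendsto (fun z : Fin d → ℤ => euclNorm z ^ d * latticeHeat (euclNorm z ^ 2 * s) z)
      (comap euclNorm atTop)
      (𝓝 (s ^ (-((d : ℝ) / 2)) * ((1 / √(4 * Real.pi)) ^ d * Real.exp (-(1 / (4 * s)))))) := by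
  have hpi := Real.pi_gt_three
  have hN : Tendsto (fun z : Fin d → ℤ => euclNorm z) (comap euclNorm atTop) atTop :=
    tendsto_comap
  have hT : Tendsto (fun z : Fin d → ℤ => euclNorm z ^ 2 * s) (comap euclNorm atTop) atTop :=
    ((tendsto_pow_atTop two_ne_zero).comp hN).atTop_mul_const hs
  have hε := ((tendsto_integral_scaledWeight_sub.comp hT).const_mul ((2 : ℝ) ^ d * d))
  rw [mul_zero] at hε
  -- The exponents add up to `|z|² / (4 |z|² s)`, so the direction of `z` disappears from the limit.
  have hprod : ∀ z : Fin d → ℤ, 0 < euclNorm z →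
      ∏ j, (1 / √(4 * Real.pi) * Real.exp (-((z j : ℝ) ^ 2 / (4 * (euclNorm z ^ 2 * s)))))
        = (1 / √(4 * Real.pi)) ^ d * Real.exp (-(1 / (4 * s))) := fun z hz => by
    rw [Finset.prod_mul_distrib, ← Real.exp_sum, Finset.sum_neg_distrib, ← Finset.sum_div,
      ← euclNorm_sq]
    congr 2
    · simp
    · field_simp
  have hev : ∀ᶠ z : Fin d → ℤ in comap euclNorm atTop, 0 < euclNorm z :=
    hN.eventually (eventually_gt_atTop 0)
  have hlim : Tendsto (fun z : Fin d → ℤ => ∏ j, (√(euclNorm z ^ 2 * s) *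
      heat (euclNorm z ^ 2 * s) (z j))) (comap euclNorm atTop)
      (𝓝 ((1 / √(4 * Real.pi)) ^ d * Real.exp (-(1 / (4 * s))))) := by
    rw [tendsto_iff_norm_sub_tendsto_zero]
    refine squeeze_zero' (Eventually.of_forall fun _ => norm_nonneg _) ?_ hε
    filter_upwards [hev] with z hz
    have ht : 0 < euclNorm z ^ 2 * s := by positivity
    rw [← hprod z hz, Real.norm_eq_abs]
    -- The common bound `2` on the factors comes from `√t · 2/√(1+t) ≤ 2`; the Gaussian factors are
    -- at most `1`.
    have := abs_prod_sub_prod_le Finset.univ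
      (fun j => √(euclNorm z ^ 2 * s) * heat (euclNorm z ^ 2 * s) (z j))
      (fun j => 1 / √(4 * Real.pi) *
        Real.exp (-((z j : ℝ) ^ 2 / (4 * (euclNorm z ^ 2 * s))))) one_le_two
      (fun j => ?_) (fun j => ?_) (fun j => abs_sqrt_mul_heat_sub_le ht (z j))
    · simpa using this
    · have h1 := (abs_heat_le _ (z j)).trans (heat_zero_le ht.le)
      have h2 : √(euclNorm z ^ 2 * s) ≤ √(1 + euclNorm z ^ 2 * s) :=
        Real.sqrt_le_sqrt (by linarith)
      have h3 := Real.sqrt_pos.2 ht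
      rw [abs_mul, abs_of_pos h3]
      refine (mul_le_mul_of_nonneg_left h1 h3.le).trans ?_
      rw [mul_div_assoc', div_le_iff₀ (h3.trans_le h2)]
      linarith
    · rw [abs_of_nonneg (by positivity)]
      have h1 : 1 / √(4 * Real.pi) ≤ 1 := by
        rw [div_le_one (by positivity)]
        exact Real.one_le_sqrt.2 (by linarith)
      have h2 : Real.exp (-((z j : ℝ) ^ 2 / (4 * (euclNorm z ^ 2 * s)))) ≤ 1 :=
        Real.exp_le_one_iff.2 (neg_nonpos.2 (by positivity))
      calc _ ≤ (1 : ℝ) * 1 := mul_le_mul h1 h2 (by positivity) zero_le_one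
        _ ≤ 2 := by norm_num
  refine (hlim.const_mul _).congr' ?_
  filter_upwards [hev] with z hz
  have e : s ^ (-((d : ℝ) / 2)) = (√s ^ d)⁻¹ := by
    rw [Real.sqrt_eq_rpow, ← Real.rpow_natCast, ← Real.rpow_mul hs.le, ← Real.rpow_neg hs.le]
    ring_nf
  have hs' := Real.sqrt_pos.2 hs
  rw [Finset.prod_mul_distrib, Finset.prod_const, Finset.card_univ, Fintype.card_fin,
    Real.sqrt_mul (by positivity), Real.sqrt_sq hz.le, mul_pow, e, latticeHeat]
  field_simp

/-- The substitution `u = 1/s` turns this into a Gamma integral with rate `1/4`; then `(4π)^{-d/2}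
4^{d/2-α}` simplifies to `4^{-α} π^{-d/2}`. -/
theorem integral_scaled_limit {d : ℕ} {α : ℝ} (hαd : α < (d : ℝ) / 2) :
    1 / Real.Gamma α * ∫ s in Set.Ioi (0 : ℝ), s ^ (α - 1) *
      (s ^ (-((d : ℝ) / 2)) * ((1 / √(4 * Real.pi)) ^ d * Real.exp (-(1 / (4 * s)))))
      = rieszConst d α := by
  have hpi := Real.pi_pos
  have h1 := integral_comp_rpow_Ioi
    (fun u : ℝ => u ^ ((d : ℝ) / 2 - α - 1) * Real.exp (-(1 / 4 * u))) (p := -1) (by norm_num)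
  rw [Real.integral_rpow_mul_exp_neg_mul_Ioi (by linarith) (by norm_num)] at h1
  have h2 : ∫ s in Set.Ioi (0 : ℝ), s ^ (α - 1) *
      (s ^ (-((d : ℝ) / 2)) * ((1 / √(4 * Real.pi)) ^ d * Real.exp (-(1 / (4 * s)))))
      = (1 / √(4 * Real.pi)) ^ d * ((1 / (1 / 4 : ℝ)) ^ ((d : ℝ) / 2 - α)
        * Real.Gamma ((d : ℝ) / 2 - α)) := by
    rw [← h1, ← integral_const_mul]
    refine setIntegral_congr_fun measurableSet_Ioi fun s hs => ?_
    have hs0 : 0 < s := hs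
    have e1 : s ^ (α - 1) * s ^ (-((d : ℝ) / 2))
        = s ^ (-1 - 1 : ℝ) * (s ^ (-1 : ℝ)) ^ ((d : ℝ) / 2 - α - 1) := by
      rw [← Real.rpow_mul hs0.le, ← Real.rpow_add hs0, ← Real.rpow_add hs0]
      ring_nf
    have e2 : 1 / 4 * s ^ (-1 : ℝ) = 1 / (4 * s) := by
      rw [Real.rpow_neg_one]
      field_simp
    simp only [smul_eq_mul]
    rw [e2, abs_neg, abs_one, one_mul, ← mul_assoc, e1]
    ring
  have h3 : (1 / √(4 * Real.pi)) ^ d = ((4 : ℝ) ^ ((d : ℝ) / 2) * Real.pi ^ ((d : ℝ) / 2))⁻¹ := by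
    rw [← Real.mul_rpow (by norm_num) hpi.le, one_div, inv_pow, Real.sqrt_eq_rpow,
      ← Real.rpow_natCast, ← Real.rpow_mul (by positivity)]
    ring_nf
  rw [h2, h3, rieszConst, one_div_one_div, Real.rpow_sub (by norm_num)]
  have := Real.rpow_pos_of_pos hpi ((d : ℝ) / 2)
  have := Real.rpow_pos_of_pos (show (0 : ℝ) < 4 by norm_num) ((d : ℝ) / 2)
  field_simp

theorem tendsto_euclNorm_rpow_mul_greenFn {d : ℕ} {α : ℝ} (hα : 0 < α)
    (hαd : α < (d : ℝ) / 2) :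
    Tendsto (fun z : Fin d → ℤ => euclNorm z ^ ((d : ℝ) - 2 * α) * greenFn α z)
      (comap euclNorm atTop) (𝓝 (rieszConst d α)) := by
  obtain ⟨C, hC⟩ := exists_scaled_latticeHeat_le (pos_of_lt_half hα hαd)
  have hev : ∀ᶠ z : Fin d → ℤ in comap euclNorm atTop, z ≠ 0 := by
    filter_upwards [tendsto_comap.eventually (eventually_gt_atTop (0 : ℝ))] with z hz h0
    subst h0
    simp [euclNorm] at hz
  rw [← integral_scaled_limit hαd]
  refine Tendsto.congr' (f₁ := fun z => 1 / Real.Gamma α * ∫ s in Set.Ioi 0, s ^ (α - 1) *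
          (euclNorm z ^ d * latticeHeat (euclNorm z ^ 2 * s) z)) ?_ ?_
  · filter_upwards [hev] with z hz
    rw [euclNorm_rpow_mul_greenFn α hz]
  refine Tendsto.const_mul _ ?_
  refine tendsto_integral_filter_of_dominated_convergence (fun s => C * majorant d α s) ?_ ?_
    ((integrableOn_majorant hα hαd).const_mul C) ?_
  · refine Eventually.of_forall fun z => ?_
    have := (continuous_latticeHeat z).measurable
    exact Measurable.aestronglyMeasurable (by fun_prop)
  · filter_upwards [hev] with z hz
    refine (ae_restrict_iff' measurableSet_Ioi).2 (ae_of_all _ fun s hs => ?_)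
    have hs0 : 0 < s := hs
    have hN := euclNorm_pos hz
    have h1 := (latticeHeat_pos (t := euclNorm z ^ 2 * s) (by positivity) z).le
    rw [Real.norm_of_nonneg (by positivity), majorant, mul_left_comm C]
    exact mul_le_mul_of_nonneg_left (hC s z hs0 hz) (Real.rpow_nonneg hs0.le _)
  · refine (ae_restrict_iff' measurableSet_Ioi).2 (ae_of_all _ fun s hs => ?_)
    exact (tendsto_scaled_latticeHeat hs).const_mul _

/-! ### Two-sided bounds and the main theorem -/

theorem rieszConst_pos {d : ℕ} {α : ℝ} (hα : 0 < α) (hαd : α < (d : ℝ) / 2) :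
    0 < rieszConst d α := by
  have h1 := Real.Gamma_pos_of_pos hα
  have h2 := Real.Gamma_pos_of_pos (sub_pos.2 hαd)
  have hpi := Real.pi_pos
  rw [rieszConst]
  positivity

/-- A positive function on `ℤ^d ∖ {0}` with a positive limit at infinity is bounded above and
bounded away from zero. -/
theorem exists_two_sided_bound {d : ℕ} (h : (Fin d → ℤ) → ℝ) (hpos : ∀ z, z ≠ 0 → 0 < h z)
    {c : ℝ} (hc : 0 < c) (hlim : Tendsto h (comap euclNorm atTop) (𝓝 c)) :
    ∃ c₂ C₂ : ℝ, 0 < c₂ ∧ 0 < C₂ ∧ ∀ z, z ≠ 0 → c₂ ≤ h z ∧ h z ≤ C₂ := by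
  have hev := hlim.eventually (Ioo_mem_nhds (half_lt_self hc) (lt_add_one c))
  obtain ⟨R, hR⟩ := eventually_atTop.1 (eventually_comap.1 hev)
  have hfin : ({z : Fin d → ℤ | euclNorm z ≤ R} \ {0}).Finite := (finite_euclNorm_le R).sdiff
  obtain ⟨M, hM⟩ := (hfin.image h).bddAbove
  obtain ⟨M', hM'⟩ := (hfin.image fun z => (h z)⁻¹).bddAbove
  have hmem : ∀ z, z ≠ 0 → euclNorm z ≤ R → z ∈ {z : Fin d → ℤ | euclNorm z ≤ R} \ {0} :=
    fun z hz hzR => ⟨hzR, hz⟩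
  -- `M'` is an arbitrary real if the finite set is empty, so `max M' 1` is what keeps the inverse
  -- positive.
  refine ⟨min (c / 2) (max M' 1)⁻¹, max (c + 1) M, lt_min (by linarith) (by positivity),
    lt_max_of_lt_left (by linarith), fun z hz => ?_⟩
  rcases le_total (euclNorm z) R with hzR | hzR
  · have h1 := hM (Set.mem_image_of_mem h (hmem z hz hzR))
    have h2 := hM' (Set.mem_image_of_mem (fun z => (h z)⁻¹) (hmem z hz hzR))
    refine ⟨(min_le_right _ _).trans ?_, h1.trans (le_max_right _ _)⟩
    rw [inv_le_comm₀ (by positivity) (hpos z hz)]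
    exact h2.trans (le_max_left _ _)
  · have := hR _ hzR z rfl
    exact ⟨(min_le_left _ _).trans this.1.le, this.2.le.trans (le_max_left _ _)⟩

end FractionalLattice

open FractionalLattice in
theorem mainTheorem6 (d : ℕ) (α : ℝ) (hα : 0 < α) (hαd : α < (d : ℝ) / 2) :
    (∀ m : ℝ, 0 < m → IsUnit (massiveOp d α m)) ∧
    ∃ G : (Fin d → ℤ) → (Fin d → ℤ) → ℝ,
      (∀ x y, Tendsto (fun m : ℝ => massiveGreen d α m x y) (𝓝[>] 0) (𝓝 (G x y : ℂ))) ∧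
      (∀ x y, IntegrableOn (fourierIntegrand α (x - y)) (zone d) volume ∧
        (G x y : ℂ) = (1 / ((2 * Real.pi : ℝ) : ℂ) ^ d) *
          ∫ k in zone d, fourierIntegrand α (x - y) k) ∧
      (∀ x y z, G (x + z) (y + z) = G x y) ∧
      (∀ x y, 0 < G x y) ∧
      Tendsto (fun p : (Fin d → ℤ) × (Fin d → ℤ) =>
          euclNorm (p.1 - p.2) ^ ((d : ℝ) - 2 * α) * G p.1 p.2)
        (comap (fun p : (Fin d → ℤ) × (Fin d → ℤ) => euclNorm (p.1 - p.2)) atTop)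
        (𝓝 (rieszConst d α)) ∧
      ∃ c₂ C₂ : ℝ, 0 < c₂ ∧ 0 < C₂ ∧ ∀ x y, x ≠ y →
        c₂ * (1 / euclNorm (x - y) ^ ((d : ℝ) - 2 * α)) ≤ G x y ∧
        G x y ≤ C₂ * (1 / euclNorm (x - y) ^ ((d : ℝ) - 2 * α)) := by
  have hlim := tendsto_euclNorm_rpow_mul_greenFn hα hαd
  refine ⟨fun m hm => isUnit_massiveOp hα hm, fun x y => greenFn α (x - y),
    tendsto_massiveGreen hα hαd,
    fun x y => ⟨integrableOn_fourierIntegrand hα hαd _, greenFn_eq_fourier hα hαd _⟩,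
    fun x y z => congrArg (greenFn α) (add_sub_add_right_eq_sub x y z),
    fun x y => greenFn_pos hα hαd _, ?_, ?_⟩
  · have hsub : Tendsto (fun p : (Fin d → ℤ) × (Fin d → ℤ) => p.1 - p.2)
        (comap (fun p : (Fin d → ℤ) × (Fin d → ℤ) => euclNorm (p.1 - p.2)) atTop)
        (comap euclNorm atTop) := tendsto_comap_iff.2 tendsto_comap
    exact hlim.comp hsub
  · obtain ⟨c₂, C₂, hc, hC, hb⟩ := exists_two_sided_bound _ (fun z hz =>
      mul_pos (Real.rpow_pos_of_pos (euclNorm_pos hz) _) (greenFn_pos hα hαd z))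
      (rieszConst_pos hα hαd) hlim
    refine ⟨c₂, C₂, hc, hC, fun x y hxy => ?_⟩
    have h0 := Real.rpow_pos_of_pos (euclNorm_pos (sub_ne_zero.2 hxy)) ((d : ℝ) - 2 * α)
    obtain ⟨h1, h2⟩ := hb _ (sub_ne_zero.2 hxy)
    rw [mul_one_div, mul_one_div, div_le_iff₀ h0, le_div_iff₀ h0, mul_comm (greenFn α (x - y))]
    exact ⟨h1, h2⟩
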